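/- Let $k$ be an algebraically closed field of characteristic $0$ and let $H$ be a finite-dimensional semisimple Hopf algebra over $k$, with $d=\dim_k H$, counit $\varepsilon$ and center $Z(H)$. Let $H^*$ be the dual algebra with product $\langle pq,h\rangle=\sum\langle p,h_1\rangle\langle q,h_2\rangle$, and let $R(H)\subseteq H^*$ be the character algebra, that is, the $k$-span of the irreducible characters of $H$. Let $\Lambda\in H$ be the left integral normalized by $\langle\chi_H,\Lambda\rangle=1$, where $\chi_H$ is the character of the left regular $H$-module, and for $a\in H$, $p\in H^*$ put $a\leftharpoonup p=\sum\langle p,a_1\rangle a_2$. Let $F_j$ be a central primitive idempotent of $R(H)$ and let $f_j$ be a primitive idempotent of $R(H)$ with $f_jF_j=f_j$. Define the class sum and the normalized class sum by $$C_j=\Lambda\leftharpoonup dF_j,\qquad \eta_j=\frac{1}{\dim_k(f_jH^*)}\,C_j .$$ Then $f_jR(H)$ is a simple right $R(H)$-module, and its character $\mu_j$, where $\langle\mu_j,x\rangle$ is the trace of right multiplication by $x$ on $f_jR(H)$ for $x\in R(H)$, is identified inside $Z(H)$ with $\eta_j$: one has $\eta_j\in Z(H)$ and $$\langle\mu_j,x\rangle=\langle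 x,\eta_j\rangle\qquad\text{for all }x\in R(H),$$ and $\eta_j$ is the only element of $Z(H)$ with this property. In particular $$\langle\varepsilon,\eta_j\rangle=m_j,$$ where $m_j=\dim_k f_jR(H)$, which is also the number of elements of any full set of primitive orthogonal idempotents of $F_jR(H)$ (pairwise orthogonal primitive idempotents of $R(H)$ with sum $F_j$). -/

import Mathlib

open scoped TensorProduct

namespace HopfCharacter

universe u v

/-- The character `a ↦ Tr_k(m ↦ a • m)` of a module `M` over a `k`-algebra `A`.
It is used for modules of finite dimension over `k`. -/
noncomputable def moduleCharacter (k A M : Type*) [Field k] [Ring A] [Algebra k A]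
    [AddCommGroup M] [Module k M] [Module A M] [IsScalarTower k A M] : A →ₗ[k] k :=
  LinearMap.trace k M ∘ₗ (Algebra.lsmul k k M).toLinearMap

/-- The dual algebra `H^*`, with the convolution product `(p * q)(h) = ∑ p(h₁) q(h₂)` and
the unit `ε`. -/
def DualAlgebra (k : Type v) (H : Type u) [Field k] [Ring H] [HopfAlgebra k H] : Type (max u v) :=
  WithConv (H →ₗ[k] k)

namespace DualAlgebra

noncomputable instance instRing (k : Type v) (H : Type u) [Field k] [Ring H] [HopfAlgebra k H] :
    Ring (DualAlgebra k H) :=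
  inferInstanceAs (Ring (WithConv (H →ₗ[k] k)))

noncomputable instance instAlgebra (k : Type v) (H : Type u) [Field k] [Ring H]
    [HopfAlgebra k H] : Algebra k (DualAlgebra k H) :=
  inferInstanceAs (Algebra k (WithConv (H →ₗ[k] k)))

/-- An element of `H^*` as a linear form on `H`. -/
def toLin {k : Type v} {H : Type u} [Field k] [Ring H] [HopfAlgebra k H] :
    DualAlgebra k H ≃ₗ[k] (H →ₗ[k] k) where
  toFun p := WithConv.ofConv p
  invFun p := WithConv.toConv p
  map_add' _ _ := rfl
  map_smul' _ _ := rfl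

theorem toLin_mul {k : Type v} {H : Type u} [Field k] [Ring H] [HopfAlgebra k H]
    (p q : DualAlgebra k H) (h : H) :
    toLin (p * q) h =
      LinearMap.mul' k k (TensorProduct.map (toLin p) (toLin q) (Coalgebra.comul (R := k) h)) :=
  rfl

theorem toLin_one {k : Type v} {H : Type u} [Field k] [Ring H] [HopfAlgebra k H] (h : H) :
    toLin (1 : DualAlgebra k H) h = Coalgebra.counit (R := k) h :=
  rfl

end DualAlgebra

/-- The characters of the finite-dimensional simple left `H`-modules, as elements of `H^*`.
Every simple `H`-module is isomorphic to a quotient of `H`, so that its universe is no restriction. -/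
def irreducibleCharacters (k : Type v) (H : Type u) [Field k] [Ring H] [HopfAlgebra k H] :
    Set (DualAlgebra k H) :=
  {χ | ∃ (V : Type u) (_ : AddCommGroup V) (_ : Module k V) (_ : Module H V)
    (_ : IsScalarTower k H V), Module.Finite k V ∧ IsSimpleModule H V ∧
      DualAlgebra.toLin χ = moduleCharacter k H V}

section Closure

/-- Additivity of the trace along an invariant subspace. -/
theorem trace_eq_trace_add_trace {k V W Q : Type*} [Field k] [AddCommGroup V] [Module k V]
    [AddCommGroup W] [Module k W] [AddCommGroup Q] [Module k Q]
    [Module.Finite k V] [Module.Finite k W] [Module.Finite k Q]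
    (i : W →ₗ[k] V) (q : V →ₗ[k] Q) (hi : Function.Injective i) (hq : Function.Surjective q)
    (hiq : Function.Exact i q)
    (f : V →ₗ[k] V) (fW : W →ₗ[k] W) (fQ : Q →ₗ[k] Q)
    (h1 : f ∘ₗ i = i ∘ₗ fW) (h2 : q ∘ₗ f = fQ ∘ₗ q) :
    LinearMap.trace k V f = LinearMap.trace k W fW + LinearMap.trace k Q fQ := by
  obtain ⟨p, hp⟩ := LinearMap.exists_leftInverse_of_injective i (LinearMap.ker_eq_bot.2 hi)
  have hs : ∃ s : Q →ₗ[k] V, s ∘ₗ q = LinearMap.id - i ∘ₗ p := by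
    obtain ⟨s0, hs0⟩ := LinearMap.exists_rightInverse_of_surjective q (LinearMap.range_eq_top.2 hq)
    refine ⟨s0 - i ∘ₗ p ∘ₗ s0, ?_⟩
    ext x
    have hx : q (s0 (q x) - x) = 0 := by
      have := LinearMap.congr_fun hs0 (q x)
      simp only [LinearMap.comp_apply, LinearMap.id_apply] at this
      simp [this]
    obtain ⟨w, hw⟩ := (hiq _).1 hx
    have hsx : s0 (q x) = x + i w := by rw [hw]; abel
    have hpw : p (i w) = w := LinearMap.congr_fun hp w
    simp [hsx, hpw]
  obtain ⟨s, hs⟩ := hs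
  have hqs : q ∘ₗ s = LinearMap.id := by
    ext y
    obtain ⟨x, rfl⟩ := hq y
    have h := LinearMap.congr_fun hs x
    simp only [LinearMap.comp_apply, LinearMap.sub_apply, LinearMap.id_apply] at h
    have hz : q (i (p x)) = 0 := (hiq _).2 ⟨_, rfl⟩
    simp [h, hz]
  have hid : f = f ∘ₗ i ∘ₗ p + (f ∘ₗ s) ∘ₗ q := by
    rw [LinearMap.comp_assoc, hs, LinearMap.comp_sub, LinearMap.comp_id]; abel
  have e1 : LinearMap.trace k V (f ∘ₗ i ∘ₗ p) = LinearMap.trace k W fW := by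
    rw [← LinearMap.comp_assoc, h1, LinearMap.comp_assoc, LinearMap.trace_comp_comm',
      LinearMap.comp_assoc, hp, LinearMap.comp_id]
  have e2 : LinearMap.trace k V ((f ∘ₗ s) ∘ₗ q) = LinearMap.trace k Q fQ := by
    rw [LinearMap.trace_comp_comm', ← LinearMap.comp_assoc, h2, LinearMap.comp_assoc, hqs,
      LinearMap.comp_id]
  rw [hid, map_add, e1, e2]

variable {k : Type v} {H : Type u} [Field k] [Ring H] [HopfAlgebra k H]

/-- The character of a finite-dimensional module is a sum of irreducible characters. -/
theorem moduleCharacter_mem_span (n : ℕ) : ∀ (V : Type u) [AddCommGroup V] [Module k V]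
    [Module H V] [IsScalarTower k H V] [Module.Finite k V], Module.finrank k V = n →
    DualAlgebra.toLin.symm (moduleCharacter k H V) ∈ Submodule.span k (irreducibleCharacters k H) := by
  induction n using Nat.strong_induction_on with
  | _ n ih =>
    intro V _ _ _ _ _ hn
    by_cases hV : Nontrivial V
    swap
    · rw [not_nontrivial_iff_subsingleton] at hV
      have : moduleCharacter k H V = 0 := by
        ext h
        have h0 : (Algebra.lsmul k k V h : V →ₗ[k] V) = 0 := Subsingleton.elim _ _
        simp [moduleCharacter, h0]
      rw [this, map_zero]
      exact Submodule.zero_mem _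
    by_cases hs : IsSimpleModule H V
    · exact Submodule.subset_span ⟨V, _, _, _, ‹_›, ‹_›, hs, LinearEquiv.apply_symm_apply _ _⟩
    have hW : ∃ W : Submodule H V, W ≠ ⊥ ∧ W ≠ ⊤ := by
      by_contra! hc
      have ho : IsSimpleOrder (Submodule H V) :=
        { exists_pair_ne := ⟨⊥, ⊤, bot_ne_top⟩
          eq_bot_or_eq_top := fun W => or_iff_not_imp_left.2 (hc W) }
      exact hs ((isSimpleModule_iff H V).2 ho)
    obtain ⟨W, hb, ht⟩ := hW
    let i : W →ₗ[k] V := W.subtype.restrictScalars k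
    let q : V →ₗ[k] V ⧸ W := W.mkQ.restrictScalars k
    have hi : Function.Injective i := W.subtype_injective
    have hq : Function.Surjective q := W.mkQ_surjective
    have hiq : Function.Exact i q := fun x => by
      simp [i, q]
    have : Module.Finite k W := Module.Finite.of_injective i hi
    have : Module.Finite k (V ⧸ W) := Module.Finite.of_surjective q hq
    have hsum : Module.finrank k V = Module.finrank k W + Module.finrank k (V ⧸ W) := by
      have h1 := LinearMap.finrank_range_add_finrank_ker q
      rw [LinearMap.range_eq_top.2 hq, finrank_top, hiq.linearMap_ker_eq,
        LinearMap.finrank_range_of_inj hi] at h1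
      omega
    have : Nontrivial W := W.nontrivial_iff_ne_bot.2 hb
    have : Nontrivial (V ⧸ W) := Submodule.Quotient.nontrivial_iff.2 ht
    have p1 : 0 < Module.finrank k W := Module.finrank_pos
    have p2 : 0 < Module.finrank k (V ⧸ W) := Module.finrank_pos
    have key : DualAlgebra.toLin.symm (moduleCharacter k H V) =
        DualAlgebra.toLin.symm (moduleCharacter k H W) +
          DualAlgebra.toLin.symm (moduleCharacter k H (V ⧸ W)) := by
      rw [← map_add]
      congr 1
      ext h
      exact trace_eq_trace_add_trace i q hi hq hiq _ _ _ (by ext x; rfl) (by ext x; rfl)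
    rw [key]
    exact Submodule.add_mem _ (ih _ (by omega) W rfl) (ih _ (by omega) (V ⧸ W) rfl)

/-- The same, for a module given by an algebra homomorphism to the endomorphisms. -/
theorem trace_comp_mem_span {V : Type u} [AddCommGroup V] [Module k V] [Module.Finite k V]
    (ρ : H →ₐ[k] Module.End k V) (χ : DualAlgebra k H)
    (hχ : ∀ h, DualAlgebra.toLin χ h = LinearMap.trace k V (ρ h)) :
    χ ∈ Submodule.span k (irreducibleCharacters k H) := by
  let _ : Module H V := Module.compHom V ρ.toRingHom
  have : IsScalarTower k H V := ⟨fun c h v => by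
    change ρ (c • h) v = c • ρ h v
    simp⟩
  have : χ = DualAlgebra.toLin.symm (moduleCharacter k H V) := by
    apply DualAlgebra.toLin.injective
    rw [LinearEquiv.apply_symm_apply]
    ext h
    rw [hχ]
    rfl
  rw [this]
  exact moduleCharacter_mem_span _ V rfl

theorem one_mem_span :
    (1 : DualAlgebra k H) ∈ Submodule.span k (irreducibleCharacters k H) := by
  refine trace_comp_mem_span (V := (Submodule.span k {(1 : H)} : Submodule k H))
    ((Algebra.ofId k _).comp (Bialgebra.counitAlgHom k H)) _ fun h => ?_
  have : Nontrivial H := ⟨⟨1, 0, fun h0 => one_ne_zero (α := k) (by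
    rw [← Bialgebra.counit_one (R := k) (A := H), h0, map_zero])⟩⟩
  have h1 : Module.finrank k (Submodule.span k {(1 : H)} : Submodule k H) = 1 :=
    finrank_span_singleton one_ne_zero
  simp [Algebra.ofId_apply, Module.algebraMap_end_eq_smul_id, h1, DualAlgebra.toLin_one]

theorem mul_mem_span (χ ψ : DualAlgebra k H)
    (hχ : χ ∈ Submodule.span k (irreducibleCharacters k H))
    (hψ : ψ ∈ Submodule.span k (irreducibleCharacters k H)) :
    χ * ψ ∈ Submodule.span k (irreducibleCharacters k H) := by
  induction hχ using Submodule.span_induction with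
  | zero => simp
  | add x y _ _ hx hy => rw [add_mul]; exact Submodule.add_mem _ hx hy
  | smul c x _ hx => rw [smul_mul_assoc]; exact Submodule.smul_mem _ _ hx
  | mem x hx =>
    induction hψ using Submodule.span_induction with
    | zero => simp
    | add y z _ _ hy hz => rw [mul_add]; exact Submodule.add_mem _ hy hz
    | smul c y _ hy => rw [mul_smul_comm]; exact Submodule.smul_mem _ _ hy
    | mem y hy =>
      obtain ⟨V, _, _, _, _, _, _, ex⟩ := hx
      obtain ⟨W, _, _, _, _, _, _, ey⟩ := hy
      refine trace_comp_mem_span (V := V ⊗[k] W)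
        ((Module.endTensorEndAlgHom (R := k) (S := k) (A := k) (M := V) (N := W)).comp
          ((Algebra.TensorProduct.map (Algebra.lsmul k k V) (Algebra.lsmul k k W)).comp
            (Bialgebra.comulAlgHom k H))) _ fun h => ?_
      rw [DualAlgebra.toLin_mul, ex, ey]
      change LinearMap.mul' k k (TensorProduct.map (moduleCharacter k H V) (moduleCharacter k H W)
        (Coalgebra.comul (R := k) h)) = LinearMap.trace k (V ⊗[k] W)
          (Module.endTensorEndAlgHom (R := k) (S := k) (A := k) (M := V) (N := W)
            (Algebra.TensorProduct.map (Algebra.lsmul k k V) (Algebra.lsmul k k W)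
              (Coalgebra.comul (R := k) h)))
      induction Coalgebra.comul (R := k) h using TensorProduct.induction_on with
      | zero => simp
      | add a b ha hb => simp only [map_add, ha, hb]
      | tmul a b =>
        simp only [TensorProduct.map_tmul, LinearMap.mul'_apply, Algebra.TensorProduct.map_tmul,
          Module.endTensorEndAlgHom_apply]
        exact (LinearMap.trace_tensorProduct' _ _).symm

end Closure

/-- The character algebra `R(H)`: the `k`-span of the irreducible characters in `H^*`. -/
noncomputable def characterAlgebra (k : Type v) (H : Type u) [Field k] [Ring H] [HopfAlgebra k H] :
    Subalgebra k (DualAlgebra k H) :=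
  (Submodule.span k (irreducibleCharacters k H)).toSubalgebra one_mem_span mul_mem_span

/-- `Λ` is a left integral of `H`, normalized by `⟨χ_H, Λ⟩ = 1`, where `χ_H` is the character of
the left regular module. -/
structure IsNormalizedIntegral (k : Type v) {H : Type u} [Field k] [Ring H] [HopfAlgebra k H]
    (Λ : H) : Prop where
  left_integral : ∀ h : H, h * Λ = Coalgebra.counit (R := k) h • Λ
  normalized : moduleCharacter k H H Λ = 1

/-- The right hit action of `H^*` on `H`: `a ↼ p = ∑ p(a₁) a₂`. -/
noncomputable def rightHit {k : Type v} {H : Type u} [Field k] [Ring H] [HopfAlgebra k H]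
    (a : H) (p : DualAlgebra k H) : H :=
  TensorProduct.lid k H (LinearMap.rTensor H (DualAlgebra.toLin p) (Coalgebra.comul (R := k) a))

/-- The defining property `⟨q, a ↼ p⟩ = ⟨p * q, a⟩` of the hit action. -/
theorem apply_rightHit {k : Type v} {H : Type u} [Field k] [Ring H] [HopfAlgebra k H]
    (a : H) (p q : DualAlgebra k H) : DualAlgebra.toLin q (rightHit a p) = DualAlgebra.toLin (p * q) a := by
  change DualAlgebra.toLin q (rightHit a p) =
    LinearMap.mul' k k (TensorProduct.map (DualAlgebra.toLin p) (DualAlgebra.toLin q) (Coalgebra.comul (R := k) a))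
  unfold rightHit
  induction Coalgebra.comul (R := k) a using TensorProduct.induction_on with
  | zero => simp
  | add x y hx hy => simp only [map_add, hx, hy]
  | tmul x y => simp

/-- A primitive idempotent: nonzero, and not a sum of two nonzero orthogonal idempotents. -/
structure IsPrimitiveIdempotent {A : Type*} [Ring A] (e : A) : Prop where
  idem : IsIdempotentElem e
  ne_zero : e ≠ 0
  indecomposable : ∀ a b : A, IsIdempotentElem a → IsIdempotentElem b → a * b = 0 → b * a = 0 →
    a + b = e → a = 0 ∨ b = 0

/-- A central primitive idempotent: central, nonzero, and not a sum of two nonzero orthogonal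
central idempotents. -/
structure IsCentralPrimitiveIdempotent {A : Type*} [Ring A] (e : A) : Prop where
  central : e ∈ Subring.center A
  idem : IsIdempotentElem e
  ne_zero : e ≠ 0
  indecomposable : ∀ a b : A, a ∈ Subring.center A → b ∈ Subring.center A →
    IsIdempotentElem a → IsIdempotentElem b → a * b = 0 → a + b = e → a = 0 ∨ b = 0

/-- A full set of primitive orthogonal idempotents of the block `F A`: pairwise orthogonal
primitive idempotents with sum `F`. -/
structure IsFullPrimitiveSystem {A : Type*} [Ring A] (F : A) {m : ℕ} (g : Fin m → A) : Prop where
  orthogonal : OrthogonalIdempotents g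
  primitive : ∀ i, IsPrimitiveIdempotent (g i)
  sum_eq : ∑ i, g i = F

/-- The right ideal `f A`, as a right `A`-module. -/
def rightIdeal {A : Type*} [Ring A] (f : A) : Submodule Aᵐᵒᵖ A :=
  Submodule.span Aᵐᵒᵖ {f}

theorem mem_rightIdeal {A : Type*} [Ring A] (f y : A) :
    y ∈ rightIdeal f ↔ ∃ x : A, f * x = y := by
  unfold rightIdeal
  rw [Submodule.mem_span_singleton]
  exact ⟨fun ⟨x, hx⟩ => ⟨x.unop, hx⟩, fun ⟨x, hx⟩ => ⟨MulOpposite.op x, hx⟩⟩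

/-- The character of the right module `f A`, at `x`: the trace of right multiplication by `x`
on `f A`. -/
noncomputable def rightIdealCharacter (k : Type*) {A : Type*} [Field k] [Ring A] [Algebra k A]
    (f x : A) : k :=
  moduleCharacter k Aᵐᵒᵖ (rightIdeal f) (MulOpposite.op x)

/-- The class sum `C = Λ ↼ (d F)`, with `d = dim H`. -/
noncomputable def classSum {k : Type v} {H : Type u} [Field k] [Ring H] [HopfAlgebra k H]
    (Λ : H) (F : characterAlgebra k H) : H :=
  rightHit Λ ((Module.finrank k H : k) • (F : DualAlgebra k H))

/-- The normalized class sum `η = (dim (f H^*))⁻¹ C`. -/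
noncomputable def normalizedClassSum {k : Type v} {H : Type u} [Field k] [Ring H]
    [HopfAlgebra k H] (Λ : H) (F f : characterAlgebra k H) : H :=
  (Module.finrank k (rightIdeal (f : DualAlgebra k H)) : k)⁻¹ • classSum Λ F

end HopfCharacter

/-!
Write `d = dim H` and `τ(p) = ⟨p, Λ⟩` for `p ∈ H^*`. Everything follows from the fact that `d τ` is
the character of the regular representation of `H^*`, which in turn rests on the theorem of Larson
and Radford that the antipode `S` of `H` is an involution.

*The antipode.* Semisimplicity makes the integral `Λ` two-sided with `ε(Λ) = 1`. Hence there is a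
form `lam` on `H` with `∑ Λ₁ lam(Λ₂) = 1`; its Nakayama automorphism is `S²`, which is therefore
inner (`IsDualIntegral.exists_antipode_sq_eq_conj`), and Radford's formula
(`IsDualIntegral.mul_rightHitL_eq`) shows that `S²` has finite order. The trace formula
`Tr(Φ) = ∑ ⟨lam, Λ₂ S(Φ(Λ₁))⟩` gives that `Tr(S²) / d` is the trace of an operator `Q` with
`Q ^ (M + 1) = Q` (`IsDualIntegral.exists_trace_eq`), hence an algebraic integer. On the other hand
`S²` is conjugation by some `g`, so that `Tr(S²)` is the sum of `tr(g) tr(g⁻¹)` over the matrix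
blocks of `H`, a sum of squared absolute values under every complex embedding, and the block of `ε`
contributes `1`. So all conjugates of `Tr(S²) / d` lie in `(0, 1]`, and by Kronecker's theorem
`Tr(S²) = d`, which forces `S² = 1` (`eq_one_of_trace_conj`, `antipode_antipode_of_isHaarIntegral`).

*The character algebra.* With `S² = 1` the trace formula says that `d τ` is the regular character of
`H^*` (`IsHaarIntegral.trace_mul`), so `τ` is a trace form and `d τ(f) = dim f H^*` for an
idempotent `f`. Moreover `Λ ↼ χ` is central for `χ ∈ R(H)`, and a central element killed by all
characters is zero by Schur's lemma (`eq_zero_of_forall_character_eq_zero`), which is the uniqueness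
statement.
It also shows that `τ` is nondegenerate on `R(H)`; as `τ` vanishes on nilpotent elements, `R(H)` is
semisimple (`IsHaarIntegral.isSemisimpleRing_characterAlgebra`).

*The block.* In a semisimple algebra over an algebraically closed field a trace form is determined
on the block of `F` by its value at `f`, since `f` generates the block and `f R(H) f = k f`. So
`τ(F x) = τ(f) ⟨μ, x⟩` with `μ` the character of `f R(H)`
(`IsCentralPrimitiveIdempotent.apply_mul_eq`). Here `⟨x, C⟩ = d τ(F x)` and `d τ(f) = dim f H^*`,
which is the claim. The same proportionality, applied to the characters themselves, shows that
every primitive idempotent of the block has trace `1` on `f R(H)`, which gives the count of a full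
system of primitive idempotents.
-/

namespace HopfCharacter

open Coalgebra HopfAlgebra

/-! ### The hit actions of a linear form on a coalgebra -/

section Hits

variable {k C : Type*} [Field k] [AddCommGroup C] [Module k C] [Coalgebra k C]

/-- The left hit action `p ⇀ c = ∑ c₁ p(c₂)` of a linear form on a coalgebra, linear in the form. -/
noncomputable def leftHitL : (C →ₗ[k] k) →ₗ[k] C →ₗ[k] C where
  toFun p := (TensorProduct.rid k C).toLinearMap ∘ₗ p.lTensor C ∘ₗ comul
  map_add' p q := by ext c; simp
  map_smul' a p := by ext c; simp

/-- The right hit action `c ↼ p = ∑ p(c₁) c₂` of a linear form on a coalgebra, linear in the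
form. -/
noncomputable def rightHitL : (C →ₗ[k] k) →ₗ[k] C →ₗ[k] C where
  toFun p := (TensorProduct.lid k C).toLinearMap ∘ₗ p.rTensor C ∘ₗ comul
  map_add' p q := by ext c; simp
  map_smul' a p := by ext c; simp

theorem leftHitL_apply (p : C →ₗ[k] k) (c : C) :
    leftHitL p c = TensorProduct.rid k C (p.lTensor C (comul c)) := rfl

theorem rightHitL_apply (p : C →ₗ[k] k) (c : C) :
    rightHitL p c = TensorProduct.lid k C (p.rTensor C (comul c)) := rfl

theorem leftHitL_eq_sum {ι : Type*} {c : C} (R : Repr k c ι) (p : C →ₗ[k] k) :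
    leftHitL p c = ∑ i ∈ R.index, p (R.right i) • R.left i := by
  simp [leftHitL_apply, ← R.eq]

theorem rightHitL_eq_sum {ι : Type*} {c : C} (R : Repr k c ι) (p : C →ₗ[k] k) :
    rightHitL p c = ∑ i ∈ R.index, p (R.left i) • R.right i := by
  simp [rightHitL_apply, ← R.eq]

theorem apply_leftHitL (p q : C →ₗ[k] k) (c : C) : p (leftHitL q c) = q (rightHitL p c) := by
  simp [leftHitL_eq_sum (ℛ k c), rightHitL_eq_sum (ℛ k c), mul_comm]

theorem counit_leftHitL (p : C →ₗ[k] k) (c : C) : counit (R := k) (leftHitL p c) = p c := by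
  conv_rhs => rw [← sum_counit_smul (ℛ k c)]
  simp [leftHitL_eq_sum (ℛ k c), mul_comm]

theorem counit_rightHitL (p : C →ₗ[k] k) (c : C) : counit (R := k) (rightHitL p c) = p c := by
  rw [← apply_leftHitL]
  congr 1
  simp [leftHitL_apply]

/-- The right hit action is a map of right comodules. -/
theorem comul_rightHitL (p : C →ₗ[k] k) (c : C) :
    comul (R := k) (rightHitL p c) = (rightHitL p).rTensor C (comul c) := by
  let T : C ⊗[k] (C ⊗[k] C) →ₗ[k] C ⊗[k] C :=
    (TensorProduct.lid k (C ⊗[k] C)).toLinearMap ∘ₗ p.rTensor (C ⊗[k] C)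
  have h := congrArg T (sum_tmul_tmul_eq (ℛ k c) (fun i => ℛ k _) (fun i => ℛ k _))
  simp only [map_sum, T, LinearMap.comp_apply, LinearMap.rTensor_tmul, LinearEquiv.coe_coe,
    TensorProduct.lid_tmul] at h
  rw [rightHitL_eq_sum (ℛ k c), ← (ℛ k c).eq]
  simp only [map_sum, map_smul, LinearMap.rTensor_tmul, rightHitL_eq_sum (ℛ k ((ℛ k c).left _)),
    TensorProduct.sum_tmul, ← TensorProduct.smul_tmul']
  rw [h]
  refine Finset.sum_congr rfl fun i _ => ?_
  rw [← Finset.smul_sum, (ℛ k ((ℛ k c).right i)).eq]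

/-- The left hit action is a map of left comodules. -/
theorem comul_leftHitL (p : C →ₗ[k] k) (c : C) :
    comul (R := k) (leftHitL p c) = (leftHitL p).lTensor C (comul c) := by
  let T : C ⊗[k] (C ⊗[k] C) →ₗ[k] C ⊗[k] C :=
    ((TensorProduct.rid k C).toLinearMap ∘ₗ p.lTensor C).lTensor C
  have h := congrArg T (sum_tmul_tmul_eq (ℛ k c) (fun i => ℛ k _) (fun i => ℛ k _))
  simp only [map_sum, T, LinearMap.comp_apply, LinearMap.lTensor_tmul, LinearEquiv.coe_coe,
    TensorProduct.rid_tmul] at h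
  rw [leftHitL_eq_sum (ℛ k c), ← (ℛ k c).eq]
  simp only [map_sum, map_smul, LinearMap.lTensor_tmul, leftHitL_eq_sum (ℛ k ((ℛ k c).right _)),
    TensorProduct.tmul_sum]
  rw [← h]
  refine Finset.sum_congr rfl fun i _ => ?_
  simp_rw [TensorProduct.tmul_smul]
  rw [← Finset.smul_sum, (ℛ k ((ℛ k c).left i)).eq]

theorem leftHitL_comp_leftHitL (p q : C →ₗ[k] k) (c : C) :
    leftHitL (p ∘ₗ leftHitL q) c = leftHitL p (leftHitL q c) := by
  rw [leftHitL_apply, leftHitL_apply, comul_leftHitL, ← LinearMap.lTensor_comp_apply]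

theorem leftHitL_comp_rightHitL (p q : C →ₗ[k] k) (c : C) :
    leftHitL (p ∘ₗ rightHitL q) c = leftHitL q (leftHitL p c) := by
  rw [← leftHitL_comp_leftHitL]
  congr 2
  ext x
  exact (apply_leftHitL q p x).symm

end Hits

/-! ### The antipode and the coproduct -/

section Antipode

variable {k H : Type*} [Field k] [Ring H] [HopfAlgebra k H]

/-- `∑ (S(h₁) ⊗ 1) Δ(h₂) = 1 ⊗ h`. -/
theorem sum_antipode_tmul_one_mul_comul {ι : Type*} {h : H} (R : Repr k h ι) :
    ∑ i ∈ R.index, (antipode k (R.left i) ⊗ₜ[k] (1 : H)) * comul (R := k) (R.right i) =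
      1 ⊗ₜ[k] h := by
  let T : H ⊗[k] (H ⊗[k] H) →ₗ[k] H ⊗[k] H :=
    (LinearMap.mul' k H ∘ₗ (antipode k).rTensor H).rTensor H ∘ₗ
      (TensorProduct.assoc k H H H).symm.toLinearMap
  have e := congrArg T (sum_tmul_tmul_eq R (fun i => ℛ k _) (fun i => ℛ k _))
  simp only [map_sum, T, LinearMap.comp_apply, LinearEquiv.coe_coe,
    TensorProduct.assoc_symm_tmul, LinearMap.rTensor_tmul, LinearMap.mul'_apply] at e
  simp_rw [← (ℛ k (R.right _)).eq, Finset.mul_sum, Algebra.TensorProduct.tmul_mul_tmul, one_mul]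
  rw [← e]
  simp_rw [← TensorProduct.sum_tmul, sum_antipode_mul_eq_smul, TensorProduct.smul_tmul,
    ← TensorProduct.tmul_sum, sum_counit_smul]

/-- `∑ Δ(h₁) (1 ⊗ S(h₂)) = h ⊗ 1`. -/
theorem sum_comul_mul_one_tmul_antipode {ι : Type*} {h : H} (R : Repr k h ι) :
    ∑ i ∈ R.index, comul (R := k) (R.left i) * ((1 : H) ⊗ₜ[k] antipode k (R.right i)) =
      h ⊗ₜ[k] 1 := by
  let T : H ⊗[k] (H ⊗[k] H) →ₗ[k] H ⊗[k] H :=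
    (LinearMap.mul' k H ∘ₗ (antipode k).lTensor H).lTensor H
  have e := congrArg T (sum_tmul_tmul_eq R (fun i => ℛ k _) (fun i => ℛ k _))
  simp only [map_sum, T, LinearMap.comp_apply, LinearMap.lTensor_tmul, LinearMap.mul'_apply] at e
  simp_rw [← (ℛ k (R.left _)).eq, Finset.sum_mul, Algebra.TensorProduct.tmul_mul_tmul, mul_one]
  rw [e]
  simp_rw [← TensorProduct.tmul_sum, sum_mul_antipode_eq_smul, TensorProduct.tmul_smul,
    TensorProduct.smul_tmul', ← TensorProduct.sum_tmul]
  congr 1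
  simpa only [map_sum, TensorProduct.rid_tmul, one_smul] using
    congrArg (TensorProduct.rid k H) (sum_tmul_counit_eq R)

/-- The antipode is an anti-homomorphism of coalgebras: both sides are convolution inverses of the
coproduct. -/
theorem comul_antipode (h : H) :
    comul (R := k) (antipode k h) =
      TensorProduct.map (antipode k) (antipode k) (TensorProduct.comm k H H (comul h)) := by
  let G : H →ₗ[k] H ⊗[k] H := TensorProduct.map (antipode k) (antipode k) ∘ₗ
    (TensorProduct.comm k H H).toLinearMap ∘ₗ comul
  have hl : WithConv.toConv G * WithConv.toConv (comul (R := k) (A := H)) = 1 := by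
    ext h
    let T : H ⊗[k] (H ⊗[k] H) →ₗ[k] H ⊗[k] H :=
      LinearMap.mul' k (H ⊗[k] H) ∘ₗ TensorProduct.map
        (TensorProduct.map (antipode k) (antipode k) ∘ₗ (TensorProduct.comm k H H).toLinearMap)
        comul ∘ₗ (TensorProduct.assoc k H H H).symm.toLinearMap
    have e := congrArg T (sum_tmul_tmul_eq (ℛ k h) (fun i => ℛ k _) (fun i => ℛ k _))
    simp only [map_sum, T, LinearMap.comp_apply, LinearEquiv.coe_coe,
      TensorProduct.assoc_symm_tmul, TensorProduct.map_tmul, TensorProduct.comm_tmul,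
      LinearMap.mul'_apply] at e
    rw [(ℛ k h).convMul_apply]
    have e1 : ∀ i, G ((ℛ k h).left i) = ∑ j ∈ (ℛ k ((ℛ k h).left i)).index,
        antipode k ((ℛ k ((ℛ k h).left i)).right j) ⊗ₜ[k]
          antipode k ((ℛ k ((ℛ k h).left i)).left j) := fun i => by
      simp only [G, LinearMap.comp_apply, ← (ℛ k ((ℛ k h).left i)).eq, map_sum,
        LinearEquiv.coe_coe, TensorProduct.comm_tmul, TensorProduct.map_tmul]
    simp only [e1, Finset.sum_mul]
    rw [e]
    have e2 : ∀ x y : H, antipode k x ⊗ₜ[k] antipode k y =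
        ((1 : H) ⊗ₜ[k] antipode k y) * (antipode k x ⊗ₜ[k] (1 : H)) := fun x y => by simp
    simp_rw [e2, mul_assoc, ← Finset.mul_sum, sum_antipode_tmul_one_mul_comul,
      Algebra.TensorProduct.tmul_mul_tmul, one_mul, ← TensorProduct.tmul_sum,
      sum_antipode_mul_eq_algebraMap_counit]
    simp [Algebra.algebraMap_eq_smul_one, TensorProduct.tmul_smul,
      Algebra.TensorProduct.one_def]
  have := left_inv_eq_right_inv hl LinearMap.comul_right_inv
  exact (congrArg (fun f : WithConv (H →ₗ[k] H ⊗[k] H) => f.ofConv h) this).symm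

theorem comul_antipode_antipode (h : H) :
    comul (R := k) (antipode k (antipode k h)) =
      TensorProduct.map (antipode k ∘ₗ antipode k) (antipode k ∘ₗ antipode k) (comul h) := by
  rw [comul_antipode, comul_antipode, ← (ℛ k h).eq]
  simp

end Antipode

/-! ### Integrals and the order of the antipode -/

section Integral

variable {k H : Type*} [Field k] [Ring H] [HopfAlgebra k H]

/-- A two-sided integral normalized by `ε(Λ) = 1`. -/
structure IsHaarIntegral (k : Type*) {H : Type*} [Field k] [Ring H] [HopfAlgebra k H] (Λ : H) :
    Prop where
  mul_left : ∀ h : H, h * Λ = counit (R := k) h • Λ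
  mul_right : ∀ h : H, Λ * h = counit (R := k) h • Λ
  counit_eq_one : counit (R := k) Λ = 1

variable {Λ : H}

theorem comul_eq_sum_leftHitL_tmul {ι : Type*} [Fintype ι] (b : Module.Basis ι k H) (h : H) :
    comul (R := k) h = ∑ i, leftHitL (b.coord i) h ⊗ₜ[k] b i := by
  simp only [leftHitL_apply]
  induction comul (R := k) h using TensorProduct.induction_on with
  | zero => simp
  | add x y hx hy => simp only [map_add, TensorProduct.add_tmul, Finset.sum_add_distrib, ← hx, ← hy]
  | tmul x y =>
    simp only [LinearMap.lTensor_tmul, TensorProduct.rid_tmul, Module.Basis.coord_apply,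
      TensorProduct.smul_tmul, ← TensorProduct.tmul_sum, b.sum_repr]

namespace IsHaarIntegral

/-- `∑ Λ₁ ⊗ h Λ₂ = ∑ S(h) Λ₁ ⊗ Λ₂`. -/
theorem one_tmul_mul_comul (hΛ : IsHaarIntegral k Λ) (h : H) :
    ((1 : H) ⊗ₜ[k] h) * comul (R := k) Λ = (antipode k h ⊗ₜ[k] 1) * comul (R := k) Λ := by
  rw [← sum_antipode_tmul_one_mul_comul (ℛ k h), Finset.sum_mul]
  simp_rw [mul_assoc, ← Bialgebra.comul_mul, hΛ.mul_left, map_smul, mul_smul_comm,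
    ← smul_mul_assoc, TensorProduct.smul_tmul', ← map_smul, ← Finset.sum_mul,
    ← TensorProduct.sum_tmul, ← map_sum]
  congr 3
  simpa only [map_sum, TensorProduct.rid_tmul, one_smul] using
    congrArg (TensorProduct.rid k H) (sum_tmul_counit_eq (ℛ k h))

/-- `∑ Λ₁ h ⊗ Λ₂ = ∑ Λ₁ ⊗ Λ₂ S(h)`. -/
theorem comul_mul_tmul_one (hΛ : IsHaarIntegral k Λ) (h : H) :
    comul (R := k) Λ * (h ⊗ₜ[k] 1) = comul (R := k) Λ * (1 ⊗ₜ[k] antipode k h) := by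
  rw [← sum_comul_mul_one_tmul_antipode (ℛ k h), Finset.mul_sum]
  simp_rw [← mul_assoc, ← Bialgebra.comul_mul, hΛ.mul_right, map_smul, smul_mul_assoc,
    ← mul_smul_comm, ← TensorProduct.tmul_smul, ← map_smul, ← Finset.mul_sum,
    ← TensorProduct.tmul_sum, ← map_sum, sum_counit_smul]

theorem mul_rightHitL (hΛ : IsHaarIntegral k Λ) (p : H →ₗ[k] k) (x : H) :
    x * rightHitL p Λ = rightHitL (p ∘ₗ LinearMap.mulLeft k (antipode k x)) Λ := by
  have := congrArg (fun Y => TensorProduct.lid k H (p.rTensor H Y)) (hΛ.one_tmul_mul_comul x)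
  simp only [← (ℛ k Λ).eq, Finset.mul_sum, Algebra.TensorProduct.tmul_mul_tmul, one_mul, map_sum,
    LinearMap.rTensor_tmul, TensorProduct.lid_tmul] at this
  simpa [rightHitL_eq_sum (ℛ k Λ), Finset.mul_sum] using this

theorem antipode_mul_leftHitL (hΛ : IsHaarIntegral k Λ) (p : H →ₗ[k] k) (x : H) :
    antipode k x * leftHitL p Λ = leftHitL (p ∘ₗ LinearMap.mulLeft k x) Λ := by
  have := congrArg (fun Y => TensorProduct.rid k H (p.lTensor H Y)) (hΛ.one_tmul_mul_comul x)
  simp only [← (ℛ k Λ).eq, Finset.mul_sum, Algebra.TensorProduct.tmul_mul_tmul, one_mul, map_sum,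
    LinearMap.lTensor_tmul, TensorProduct.rid_tmul] at this
  simpa [leftHitL_eq_sum (ℛ k Λ), Finset.mul_sum] using this.symm

theorem leftHitL_mul (hΛ : IsHaarIntegral k Λ) (p : H →ₗ[k] k) (x : H) :
    leftHitL p Λ * x = leftHitL (p ∘ₗ LinearMap.mulRight k (antipode k x)) Λ := by
  have := congrArg (fun Y => TensorProduct.rid k H (p.lTensor H Y)) (hΛ.comul_mul_tmul_one x)
  simp only [← (ℛ k Λ).eq, Finset.sum_mul, Algebra.TensorProduct.tmul_mul_tmul, mul_one, map_sum,
    LinearMap.lTensor_tmul, TensorProduct.rid_tmul] at this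
  simpa [leftHitL_eq_sum (ℛ k Λ), Finset.sum_mul] using this

theorem rightHitL_mul_antipode (hΛ : IsHaarIntegral k Λ) (p : H →ₗ[k] k) (x : H) :
    rightHitL p Λ * antipode k x = rightHitL (p ∘ₗ LinearMap.mulRight k x) Λ := by
  have := congrArg (fun Y => TensorProduct.lid k H (p.rTensor H Y)) (hΛ.comul_mul_tmul_one x)
  simp only [← (ℛ k Λ).eq, Finset.sum_mul, Algebra.TensorProduct.tmul_mul_tmul, mul_one, map_sum,
    LinearMap.rTensor_tmul, TensorProduct.lid_tmul] at this
  simpa [rightHitL_eq_sum (ℛ k Λ), Finset.sum_mul] using this.symm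

/-- The elements `p ⇀ Λ` fill `H`: they form a right ideal, which contains
`∑ Λ₁ S(Λ₂) = ε(Λ) = 1`. -/
theorem exists_leftHitL_eq [Module.Finite k H] (hΛ : IsHaarIntegral k Λ) (x : H) :
    ∃ p : H →ₗ[k] k, leftHitL p Λ = x := by
  suffices h1 : ∃ p : H →ₗ[k] k, leftHitL p Λ = 1 by
    obtain ⟨p, hp⟩ := h1
    exact ⟨_, by rw [← hΛ.leftHitL_mul p x, hp, one_mul]⟩
  let P : Submodule k H := LinearMap.range ((leftHitL (k := k) (C := H)).flip Λ)
  suffices h1 : (1 : H) ∈ P by simpa [P] using h1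
  have hP : ∀ y ∈ P, ∀ x : H, y * x ∈ P := by
    rintro _ ⟨p, rfl⟩ x
    exact ⟨_, (hΛ.leftHitL_mul p x).symm⟩
  have h1 := mul_antipode_lTensor_comul_apply (R := k) Λ
  rw [hΛ.counit_eq_one, map_one, comul_eq_sum_leftHitL_tmul (Module.finBasis k H)] at h1
  simp only [map_sum, LinearMap.lTensor_tmul, LinearMap.mul'_apply] at h1
  rw [← h1]
  exact P.sum_mem fun i _ => hP _ ⟨_, rfl⟩ _

theorem leftHitL_injective [Module.Finite k H] (hΛ : IsHaarIntegral k Λ) {p q : H →ₗ[k] k}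
    (h : leftHitL p Λ = leftHitL q Λ) : p = q := by
  have hs : Function.Surjective ((leftHitL (k := k) (C := H)).flip Λ) := hΛ.exists_leftHitL_eq
  exact ((LinearMap.injective_iff_surjective_of_finrank_eq_finrank
    Subspace.dual_finrank_eq).2 hs) h

theorem rightHitL_injective [Module.Finite k H] (hΛ : IsHaarIntegral k Λ) {p q : H →ₗ[k] k}
    (h : rightHitL p Λ = rightHitL q Λ) : p = q := by
  ext x
  obtain ⟨r, rfl⟩ := hΛ.exists_leftHitL_eq x
  rw [apply_leftHitL, apply_leftHitL, h]

end IsHaarIntegral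

/-- A group-like element of a finite-dimensional Hopf algebra has finite order, since distinct
group-like elements are linearly independent. -/
theorem exists_pow_eq_one_of_isGroupLikeElem [Module.Finite k H] {a : H}
    (ha : IsGroupLikeElem k a) : ∃ N : ℕ, 0 < N ∧ a ^ N = 1 := by
  by_contra! hN
  obtain ⟨u, rfl⟩ := ha.isUnit
  have hinj : Function.Injective fun n : ℕ => (u : H) ^ n := by
    intro m n hmn
    by_contra hne
    wlog h : m < n generalizing m n
    · exact this hmn.symm (Ne.symm hne) (by omega)
    refine hN (n - m) (by omega) ?_
    have : (u : H) ^ m * (u : H) ^ (n - m) = (u : H) ^ m * 1 := by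
      rw [← pow_add, mul_one, Nat.add_sub_cancel' h.le]
      exact hmn.symm
    exact (u.isUnit.pow m).mul_left_cancel this
  have hli := (linearIndepOn_isGroupLikeElem (R := k) (A := H)).comp
    (fun n : ℕ => (⟨(u : H) ^ n, ha.pow⟩ : {a : H | IsGroupLikeElem k a}))
    (fun m n h => hinj (congrArg Subtype.val h))
  have := hli.finite
  exact not_finite ℕ

/-- `lam` is dual to the integral `Λ`: `lam ⇀ Λ = 1`. -/
def IsDualIntegral (Λ : H) (lam : H →ₗ[k] k) : Prop := leftHitL lam Λ = 1

namespace IsDualIntegral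

variable {lam : H →ₗ[k] k}

theorem apply_integral (hl : IsDualIntegral Λ lam) : lam Λ = 1 := by
  rw [← counit_leftHitL, hl, Bialgebra.counit_one]

theorem leftHitL_mulRight_antipode (hl : IsDualIntegral Λ lam) (hΛ : IsHaarIntegral k Λ) (x : H) :
    leftHitL (lam ∘ₗ LinearMap.mulRight k (antipode k x)) Λ = x := by
  rw [← hΛ.leftHitL_mul, hl, one_mul]

theorem leftHitL_mulLeft (hl : IsDualIntegral Λ lam) (hΛ : IsHaarIntegral k Λ) (x : H) :
    leftHitL (lam ∘ₗ LinearMap.mulLeft k x) Λ = antipode k x := by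
  rw [← hΛ.antipode_mul_leftHitL, hl, mul_one]

theorem antipode_injective (hl : IsDualIntegral Λ lam) (hΛ : IsHaarIntegral k Λ) :
    Function.Injective (antipode k (A := H)) := fun x y h => by
  rw [← hl.leftHitL_mulRight_antipode hΛ x, h, hl.leftHitL_mulRight_antipode hΛ]

variable [Module.Finite k H]

/-- The square of the antipode is the Nakayama automorphism of the dual integral. -/
theorem apply_mul_comm (hl : IsDualIntegral Λ lam) (hΛ : IsHaarIntegral k Λ) (x y : H) :
    lam (x * y) = lam (y * antipode k (antipode k x)) := by
  have : lam ∘ₗ LinearMap.mulLeft k x =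
      lam ∘ₗ LinearMap.mulRight k (antipode k (antipode k x)) := by
    apply hΛ.leftHitL_injective
    rw [hl.leftHitL_mulLeft hΛ, hl.leftHitL_mulRight_antipode hΛ]
  exact LinearMap.congr_fun this y

/-- The dual integral is a left integral of `H^*`. -/
theorem leftHitL_eq (hl : IsDualIntegral Λ lam) (hΛ : IsHaarIntegral k Λ) (h : H) :
    leftHitL lam h = lam h • (1 : H) := by
  rw [← sub_eq_zero]
  refine (Module.forall_dual_apply_eq_zero_iff k _).1 fun q => ?_
  have : lam ∘ₗ rightHitL q = q 1 • lam := by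
    apply hΛ.leftHitL_injective
    rw [leftHitL_comp_rightHitL, hl, map_smul, LinearMap.smul_apply, hl, leftHitL_apply,
      Bialgebra.comul_one]
    simp [Algebra.TensorProduct.one_def]
  have h' := LinearMap.congr_fun this h
  rw [LinearMap.comp_apply] at h'
  rw [map_sub, apply_leftHitL, h', map_smul]
  simp [mul_comm]

/-- `lam ↼ H` is spanned by the distinguished group-like element `a = Λ ↼ lam`, since left
integrals of `H^*` are unique up to scalars. -/
theorem rightHitL_eq (hl : IsDualIntegral Λ lam) (hΛ : IsHaarIntegral k Λ) (h : H) :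
    rightHitL lam h = lam h • rightHitL lam Λ := by
  rw [← sub_eq_zero]
  refine (Module.forall_dual_apply_eq_zero_iff k _).1 fun q => ?_
  have : lam ∘ₗ leftHitL q = q (rightHitL lam Λ) • lam := by
    apply hΛ.leftHitL_injective
    rw [leftHitL_comp_leftHitL, hl.leftHitL_eq hΛ, apply_leftHitL, map_smul,
      LinearMap.smul_apply, hl]
  have h' := LinearMap.congr_fun this h
  rw [LinearMap.comp_apply] at h'
  rw [map_sub, ← apply_leftHitL, h', map_smul]
  simp [mul_comm]

theorem isGroupLikeElem (hl : IsDualIntegral Λ lam) (hΛ : IsHaarIntegral k Λ) :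
    IsGroupLikeElem k (rightHitL lam Λ) where
  counit_eq_one := by rw [counit_rightHitL, hl.apply_integral]
  comul_eq_tmul_self := by
    have h2 := congrArg (fun y => rightHitL lam Λ ⊗ₜ[k] y) (rightHitL_eq_sum (ℛ k Λ) lam)
    refine Eq.trans ?_ h2.symm
    rw [comul_rightHitL, ← (ℛ k Λ).eq]
    simp only [map_sum, LinearMap.rTensor_tmul, hl.rightHitL_eq hΛ ((ℛ k Λ).left _),
      TensorProduct.tmul_sum, TensorProduct.smul_tmul]

/-- Radford's formula for a unimodular Hopf algebra: `S⁴` is conjugation by the distinguished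
group-like element. -/
theorem mul_rightHitL_eq (hl : IsDualIntegral Λ lam) (hΛ : IsHaarIntegral k Λ) (z : H) :
    z * rightHitL lam Λ =
      rightHitL lam Λ * antipode k (antipode k (antipode k (antipode k z))) := by
  rw [hΛ.mul_rightHitL, hΛ.rightHitL_mul_antipode]
  congr 2
  ext x
  exact hl.apply_mul_comm hΛ _ _

/-- The square of the antipode has finite order, by Radford's formula and the finite order of the
distinguished group-like element. -/
theorem exists_antipode_iterate_eq (hl : IsDualIntegral Λ lam) (hΛ : IsHaarIntegral k Λ) :
    ∃ M : ℕ, 0 < M ∧ (antipode k ∘ₗ antipode k : Module.End k H) ^ M = 1 := by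
  obtain ⟨N, hN, ha⟩ := exists_pow_eq_one_of_isGroupLikeElem (hl.isGroupLikeElem hΛ)
  refine ⟨2 * N, by omega, LinearMap.ext fun z => ?_⟩
  set a := rightHitL lam Λ
  set T : Module.End k H := antipode k ∘ₗ antipode k
  have h : ∀ n : ℕ, ∀ z, z * a ^ n = a ^ n * (T ^ (2 * n)) z := by
    intro n
    induction n with
    | zero => intro z; simp
    | succ n ih =>
      intro z
      rw [pow_succ, ← mul_assoc, ih, mul_assoc, hl.mul_rightHitL_eq hΛ, ← mul_assoc]
      congr 1
      rw [show 2 * (n + 1) = 2 + 2 * n by ring, pow_add, pow_two]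
      rfl
  have := h N z
  rw [ha, mul_one, one_mul] at this
  exact this.symm

end IsDualIntegral

end Integral

/-! ### Trace formulas -/

section ComulMul

variable {k H : Type*} [Field k] [Ring H] [HopfAlgebra k H]

theorem leftHitL_mul_map (p q : H →ₗ[k] k) :
    leftHitL (C := H ⊗[k] H) (LinearMap.mul' k k ∘ₗ TensorProduct.map p q) =
      TensorProduct.map (leftHitL p) (leftHitL q) := by
  ext a b
  simp only [TensorProduct.AlgebraTensorModule.curry_apply, TensorProduct.curry_apply,
    LinearMap.coe_restrictScalars, TensorProduct.map_tmul]
  rw [leftHitL_eq_sum ((ℛ k a).tmul (ℛ k b)), leftHitL_eq_sum (ℛ k a), leftHitL_eq_sum (ℛ k b)]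
  simp only [TensorProduct.sum_tmul, TensorProduct.tmul_sum]
  rw [Finset.sum_comm]
  refine (Finset.sum_product _ _ _).trans
    (Finset.sum_congr rfl fun i _ => Finset.sum_congr rfl fun j _ => ?_)
  simp [Repr.tmul, TensorProduct.smul_tmul', TensorProduct.tmul_smul, smul_smul, mul_comm]

/-- The map `h ⊗ h' ↦ h₁ ⊗ h₂ h'`. -/
noncomputable def comulMul (k H : Type*) [Field k] [Ring H] [HopfAlgebra k H] :
    H ⊗[k] H →ₗ[k] H ⊗[k] H :=
  (LinearMap.mul' k H).lTensor H ∘ₗ (TensorProduct.assoc k H H H).toLinearMap ∘ₗ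
    (comul (R := k)).rTensor H

theorem comulMul_tmul (a b : H) : comulMul k H (a ⊗ₜ b) = comul a * ((1 : H) ⊗ₜ[k] b) := by
  rw [comulMul, ← (ℛ k a).eq]
  simp [TensorProduct.sum_tmul, ← (ℛ k a).eq, Finset.sum_mul]

theorem leftHitL_mul (p : H →ₗ[k] k) (a b : H) :
    leftHitL p (a * b) = ∑ i ∈ (ℛ k b).index,
      leftHitL (p ∘ₗ LinearMap.mulRight k ((ℛ k b).right i)) a * (ℛ k b).left i := by
  simp_rw [leftHitL_apply p, Bialgebra.comul_mul, leftHitL_eq_sum (ℛ k a)]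
  simp [← (ℛ k a).eq, ← (ℛ k b).eq, Finset.sum_mul, Finset.mul_sum]

/-- The map `comulMul` intertwines the operators of `p ∘ mul` on `H ⊗ H` and of `1 ⊗ p`. -/
theorem comulMul_leftHitL (p : H →ₗ[k] k) (X : H ⊗[k] H) :
    comulMul k H (leftHitL (p ∘ₗ LinearMap.mul' k H) X) =
      (leftHitL p).lTensor H (comulMul k H X) := by
  induction X using TensorProduct.induction_on with
  | zero => simp
  | add X Y hX hY => simp only [map_add, hX, hY]
  | tmul a b =>
    have h1 : ∀ Y : H ⊗[k] H, (leftHitL p).lTensor H (Y * ((1 : H) ⊗ₜ[k] b)) =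
        ∑ j ∈ (ℛ k b).index, (leftHitL (p ∘ₗ LinearMap.mulRight k ((ℛ k b).right j))).lTensor H Y *
          ((1 : H) ⊗ₜ[k] (ℛ k b).left j) := by
      intro Y
      induction Y using TensorProduct.induction_on with
      | zero => simp
      | add X Y hX hY => simp only [add_mul, map_add, hX, hY, Finset.sum_add_distrib]
      | tmul x y =>
        simp only [Algebra.TensorProduct.tmul_mul_tmul, LinearMap.lTensor_tmul, mul_one,
          leftHitL_mul, TensorProduct.tmul_sum]
    rw [comulMul_tmul, h1, leftHitL_eq_sum ((ℛ k a).tmul (ℛ k b))]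
    simp_rw [← comul_leftHitL, leftHitL_eq_sum (ℛ k a)]
    simp only [map_sum, map_smul, Finset.sum_mul]
    rw [Finset.sum_comm]
    refine (Finset.sum_product _ _ _).trans
      (Finset.sum_congr rfl fun i _ => Finset.sum_congr rfl fun j _ => ?_)
    simp [Repr.tmul, comulMul_tmul]

end ComulMul

section TraceFormula

variable {k H : Type*} [Field k] [Ring H] [HopfAlgebra k H] [Module.Finite k H]

namespace IsDualIntegral

variable {Λ : H} {lam : H →ₗ[k] k}

/-- The trace formula `Tr(Φ) = ∑ ⟨lam, Λ₂ S(Φ(Λ₁))⟩`. -/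
theorem trace_eq_sum (hl : IsDualIntegral Λ lam) (hΛ : IsHaarIntegral k Λ) {ι : Type*}
    (R : Repr k Λ ι) (Φ : Module.End k H) :
    LinearMap.trace k H Φ = ∑ i ∈ R.index, lam (R.right i * antipode k (Φ (R.left i))) := by
  have h : Φ = ∑ i ∈ R.index,
      (lam ∘ₗ LinearMap.mulLeft k (R.right i) ∘ₗ antipode k).smulRight (Φ (R.left i)) := by
    ext x
    conv_lhs => rw [← hl.leftHitL_mulRight_antipode hΛ x, leftHitL_eq_sum R]
    simp
  conv_lhs => rw [h]
  simp only [map_sum, LinearMap.trace_smulRight]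
  rfl

theorem trace_antipode_sq_comp_mulRight (hl : IsDualIntegral Λ lam) (hΛ : IsHaarIntegral k Λ)
    (x : H) :
    LinearMap.trace k H ((antipode k ∘ₗ antipode k) ∘ₗ LinearMap.mulRight k x) =
      lam (antipode k x) := by
  rw [hl.trace_eq_sum hΛ (ℛ k Λ)]
  have : ∀ i, lam ((ℛ k Λ).right i * antipode k (((antipode k ∘ₗ antipode k) ∘ₗ
      LinearMap.mulRight k x) ((ℛ k Λ).left i))) =
      lam (antipode k x * (antipode k ((ℛ k Λ).left i) * (ℛ k Λ).right i)) := fun i => by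
    rw [← mul_assoc, hl.apply_mul_comm hΛ (antipode k x * _)]
    simp [antipode_mul_antidistrib]
  simp_rw [this, ← map_sum, ← Finset.mul_sum, sum_antipode_mul_eq_smul, hΛ.counit_eq_one,
    one_smul, mul_one]

theorem trace_antipode_sq (hl : IsDualIntegral Λ lam) (hΛ : IsHaarIntegral k Λ) :
    LinearMap.trace k H (antipode k ∘ₗ antipode k) = lam 1 := by
  have := hl.trace_antipode_sq_comp_mulRight hΛ 1
  rwa [LinearMap.mulRight_one, LinearMap.comp_id, antipode_one] at this

/-- If `S² = 1`, then `d Λ` is the character of the regular representation of `H^*`; here the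
operator `h ↦ h ↼ p` is the transpose of left multiplication by `p`. -/
theorem trace_rightHitL (hl : IsDualIntegral Λ lam) (hΛ : IsHaarIntegral k Λ)
    (hS : ∀ h : H, antipode k (antipode k h) = h) (p : H →ₗ[k] k) :
    LinearMap.trace k H (rightHitL p) = Module.finrank k H * p Λ := by
  rw [hl.trace_eq_sum hΛ (ℛ k Λ)]
  have hc : ∀ x y, lam (x * y) = lam (y * x) := fun x y => by rw [hl.apply_mul_comm hΛ, hS]
  simp_rw [fun i => hc ((ℛ k Λ).right i)]
  have h1 := mul_antipode_rTensor_comul_apply (R := k) (rightHitL p Λ)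
  rw [comul_rightHitL, ← (ℛ k Λ).eq, counit_rightHitL] at h1
  simp only [map_sum, LinearMap.rTensor_tmul, LinearMap.mul'_apply] at h1
  have h2 : (antipode k ∘ₗ antipode k : Module.End k H) = 1 := LinearMap.ext hS
  rw [← map_sum, h1, Algebra.algebraMap_eq_smul_one, map_smul, ← hl.trace_antipode_sq hΛ, h2,
    LinearMap.trace_one, smul_eq_mul, mul_comm]

end IsDualIntegral

/-- The character of the regular representation of `H^*`, as an element of `H`. -/
theorem exists_apply_eq_trace_leftHitL (k H : Type*) [Field k] [Ring H] [HopfAlgebra k H]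
    [Module.Finite k H] :
    ∃ y : H, ∀ p : H →ₗ[k] k, p y = LinearMap.trace k H (leftHitL p) := by
  obtain ⟨y, hy⟩ := (Module.evalEquiv k H).surjective (LinearMap.trace k H ∘ₗ leftHitL)
  exact ⟨y, fun p => LinearMap.congr_fun hy p⟩

/-- The regular character of the tensor square of `H^*` is `y ⊗ y`. -/
theorem trace_leftHitL_tensor {y : H}
    (hy : ∀ p : H →ₗ[k] k, p y = LinearMap.trace k H (leftHitL p)) (P : H ⊗[k] H →ₗ[k] k) :
    LinearMap.trace k (H ⊗[k] H) (leftHitL P) = P (y ⊗ₜ y) := by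
  obtain ⟨P, rfl⟩ := (TensorProduct.dualDistribEquiv k H H).surjective P
  induction P using TensorProduct.induction_on with
  | zero => simp
  | add P Q hP hQ => simp only [map_add, hP, hQ, LinearMap.add_apply]
  | tmul p q =>
    have : TensorProduct.dualDistribEquiv k H H (p ⊗ₜ q) =
        LinearMap.mul' k k ∘ₗ TensorProduct.map p q := by
      ext a b
      simp [TensorProduct.dualDistribEquiv, TensorProduct.dualDistribEquivOfBasis]
    rw [this, leftHitL_mul_map, LinearMap.trace_tensorProduct', ← hy, ← hy]
    simp

theorem comulMul_bijective : Function.Bijective (comulMul k H) := by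
  have hs : Function.Surjective (comulMul k H) := by
    intro X
    induction X using TensorProduct.induction_on with
    | zero => exact ⟨0, map_zero _⟩
    | add X Y hX hY =>
      obtain ⟨a, rfl⟩ := hX
      obtain ⟨b, rfl⟩ := hY
      exact ⟨a + b, map_add _ _ _⟩
    | tmul a b =>
      refine ⟨∑ i ∈ (ℛ k a).index, (ℛ k a).left i ⊗ₜ (antipode k ((ℛ k a).right i) * b), ?_⟩
      have : ∀ x : H, (1 : H) ⊗ₜ[k] (x * b) = ((1 : H) ⊗ₜ[k] x) * ((1 : H) ⊗ₜ[k] b) := by simp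
      simp_rw [map_sum, comulMul_tmul, this, ← mul_assoc, ← Finset.sum_mul,
        sum_comul_mul_one_tmul_antipode]
      simp
  exact ⟨LinearMap.injective_iff_surjective.2 hs, hs⟩

/-- The regular character `y` of `H^*` satisfies `y² = d y`: up to conjugation by `comulMul`, the
form `p ∘ mul` acts on `H ⊗ H` as `1 ⊗ p`. -/
theorem mul_self_of_apply_eq_trace {y : H}
    (hy : ∀ p : H →ₗ[k] k, p y = LinearMap.trace k H (leftHitL p)) :
    y * y = (Module.finrank k H : k) • y := by
  rw [← sub_eq_zero]
  refine (Module.forall_dual_apply_eq_zero_iff k _).1 fun p => ?_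
  have h1 := trace_leftHitL_tensor hy (p ∘ₗ LinearMap.mul' k H)
  let e := LinearEquiv.ofBijective _ (comulMul_bijective (k := k) (H := H))
  have h2 : e.conj (leftHitL (p ∘ₗ LinearMap.mul' k H)) =
      TensorProduct.map LinearMap.id (leftHitL p) := by
    ext1
    ext1 a
    ext1 b
    obtain ⟨X, hX⟩ := e.surjective (a ⊗ₜ b)
    have := comulMul_leftHitL p X
    simp only [TensorProduct.AlgebraTensorModule.curry_apply, TensorProduct.curry_apply,
      LinearMap.coe_restrictScalars, LinearEquiv.conj_apply_apply, ← hX, e.symm_apply_apply]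
    exact this
  rw [← LinearMap.trace_conj' _ e, h2, LinearMap.trace_tensorProduct', ← hy,
    LinearMap.trace_id] at h1
  simpa [sub_eq_zero] using h1.symm

/-- The regular character of `H^*` is fixed by the coalgebra automorphism `S²`. -/
theorem antipode_sq_of_apply_eq_trace {y : H}
    (hy : ∀ p : H →ₗ[k] k, p y = LinearMap.trace k H (leftHitL p))
    (hS : Function.Injective (antipode k (A := H))) :
    antipode k (antipode k y) = y := by
  rw [← sub_eq_zero]
  refine (Module.forall_dual_apply_eq_zero_iff k _).1 fun p => ?_
  let T : Module.End k H := antipode k ∘ₗ antipode k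
  have hT : Function.Injective T := hS.comp hS
  let e := LinearEquiv.ofInjectiveEndo T hT
  have h1 : e.conj (leftHitL (p ∘ₗ T)) = leftHitL p := by
    ext h
    obtain ⟨h, rfl⟩ := e.surjective h
    rw [LinearEquiv.conj_apply_apply, e.symm_apply_apply]
    change T _ = leftHitL p (T h)
    rw [leftHitL_apply p]
    change _ = TensorProduct.rid k H (p.lTensor H (comul (antipode k (antipode k h))))
    rw [comul_antipode_antipode, leftHitL_eq_sum (ℛ k h), ← (ℛ k h).eq]
    simp [T]
  have h2 := hy (p ∘ₗ T)
  rw [← LinearMap.trace_conj' _ e, h1, ← hy] at h2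
  rw [map_sub, sub_eq_zero]
  exact h2

/-- `Tr(S²) / dim H` is the trace of an operator `Q` with `Q ^ (M + 1) = Q`, where `M` is a period
of `S²`. -/
theorem IsDualIntegral.exists_trace_eq {Λ : H} {lam : H →ₗ[k] k} (hl : IsDualIntegral Λ lam)
    (hΛ : IsHaarIntegral k Λ) (hd : (Module.finrank k H : k) ≠ 0) {M : ℕ}
    (hT : (antipode k ∘ₗ antipode k : Module.End k H) ^ M = 1) :
    ∃ Q : Module.End k H, Q ^ (M + 1) = Q ∧
      LinearMap.trace k H (antipode k ∘ₗ antipode k) =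
        Module.finrank k H * LinearMap.trace k H Q := by
  obtain ⟨y, hy⟩ := exists_apply_eq_trace_leftHitL k H
  have hS := hl.antipode_injective hΛ
  obtain ⟨x, rfl⟩ := LinearMap.injective_iff_surjective.1 hS y
  have hxx : x * x = (Module.finrank k H : k) • x := hS (by
    rw [antipode_mul_antidistrib, mul_self_of_apply_eq_trace hy, map_smul])
  have hx2 : antipode k (antipode k x) = x := hS (antipode_sq_of_apply_eq_trace hy hS)
  have hlx : lam (antipode k x) = lam 1 := by
    rw [hy lam, show leftHitL lam = lam.smulRight (1 : H) from
      LinearMap.ext (hl.leftHitL_eq hΛ), LinearMap.trace_smulRight]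
  set T : Module.End k H := antipode k ∘ₗ antipode k
  -- `E` is idempotent since `x² = d x`, and commutes with `T` since `S²(x) = x`
  let E : Module.End k H := (Module.finrank k H : k)⁻¹ • LinearMap.mulRight k x
  have hE : E * E = E := by
    ext h
    simp [E, mul_assoc, hxx, hd, smul_smul]
  have hTE : Commute T E := by
    ext h
    simp [E, T, antipode_mul_antidistrib, hx2]
  refine ⟨T * E, ?_, ?_⟩
  · rw [hTE.mul_pow, pow_succ, hT, one_mul, IsIdempotentElem.pow_succ_eq _ hE]
  · have h1 := hl.trace_antipode_sq_comp_mulRight hΛ x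
    have h2 : T * E = (Module.finrank k H : k)⁻¹ • (T ∘ₗ LinearMap.mulRight k x) := by
      ext h
      simp [E]
    rw [h2, map_smul, h1, hlx, hl.trace_antipode_sq hΛ, smul_eq_mul, mul_inv_cancel_left₀ hd]

end TraceFormula

/-! ### Operators of finite order -/

section FiniteOrder

variable {k : Type*} [Field k]

theorem trace_eq_sum_of_eigenbasis {V : Type*} [AddCommGroup V] [Module k V] {ι : Type*}
    [Fintype ι] (b : Module.Basis ι k V) (T : Module.End k V) (c : ι → k)
    (h : ∀ j, T (b j) = c j • b j) : LinearMap.trace k V T = ∑ j, c j := by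
  classical
  rw [LinearMap.trace_eq_matrix_trace k b, Matrix.trace]
  refine Finset.sum_congr rfl fun j _ => ?_
  simp [LinearMap.toMatrix_apply, h]

variable [IsAlgClosed k]

/-- The trace of an operator with `Q ^ (M + 1) = Q` is an algebraic integer. -/
theorem isIntegral_trace_of_pow_succ_eq {V : Type*} [AddCommGroup V] [Module k V]
    [Module.Finite k V] {M : ℕ} (hM : 0 < M) {Q : Module.End k V} (hQ : Q ^ (M + 1) = Q) :
    IsIntegral ℤ (LinearMap.trace k V Q) := by
  rw [Module.End.trace_eq_sum_roots_charpoly_of_splits (IsAlgClosed.splits _)]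
  refine IsIntegral.multiset_sum fun μ hμ => ?_
  have h1 : Q.HasEigenvalue μ :=
    (Q.hasEigenvalue_iff_isRoot_charpoly μ).2 (Polynomial.isRoot_of_mem_roots hμ)
  obtain ⟨v, hv⟩ := h1.exists_hasEigenvector
  have h2 := hv.pow_apply (M + 1)
  rw [hQ, hv.apply_eq_smul] at h2
  have h3 : μ ^ (M + 1) - μ = 0 := by
    refine (smul_eq_zero.1 (?_ : (μ ^ (M + 1) - μ) • v = 0)).resolve_right hv.2
    rw [sub_smul, ← h2, sub_self]
  refine ⟨Polynomial.X ^ (M + 1) - Polynomial.X,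
    Polynomial.monic_X_pow_sub ?_, by simpa using h3⟩
  rw [Polynomial.degree_X]
  exact_mod_cast Nat.lt_succ_of_le hM

variable [CharZero k]

/-- An operator of finite order over an algebraically closed field of characteristic zero is
diagonalizable, with roots of unity as eigenvalues. -/
theorem exists_eigenbasis_of_pow_eq_one {V : Type*} [AddCommGroup V] [Module k V]
    [Module.Finite k V] {M : ℕ} [NeZero M] {ω : k} (hω : IsPrimitiveRoot ω M) {T : Module.End k V}
    (hT : T ^ M = 1) :
    ∃ (b : Module.Basis (Fin (Module.finrank k V)) k V) (e : Fin (Module.finrank k V) → ℕ),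
      ∀ j, T (b j) = ω ^ e j • b j := by
  classical
  have hM : (M : k) ≠ 0 := Nat.cast_ne_zero.2 (NeZero.ne M)
  have hs : T.IsSemisimple := Module.End.isSemisimple_of_squarefree_aeval_eq_zero
    (p := Polynomial.X ^ M - Polynomial.C 1)
    (Polynomial.separable_X_pow_sub_C 1 hM one_ne_zero).squarefree (by simp [hT])
  have hint : DirectSum.IsInternal T.eigenspace :=
    DirectSum.isInternal_submodule_of_iSupIndep_of_iSup_eq_top T.eigenspaces_iSupIndep
      hs.iSup_eigenspace_eq_top
  let b₀ := hint.collectedBasis fun μ => Module.finBasis k (T.eigenspace μ)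
  have := Module.Finite.finite_basis b₀
  have := Fintype.ofFinite (Σ μ : k, Fin (Module.finrank k (T.eigenspace μ)))
  let s := Fintype.equivFinOfCardEq (Module.finrank_eq_card_basis b₀).symm
  let b := b₀.reindex s
  have hb : ∀ j, ∃ μ : k, T (b j) = μ • b j := fun j =>
    ⟨(s.symm j).1, by
      rw [Module.Basis.reindex_apply]
      exact Module.End.mem_eigenspace_iff.1 (hint.collectedBasis_mem _ _)⟩
  choose μ hμ using hb
  have hμM : ∀ j, μ j ^ M = 1 := fun j => by
    have h1 : ∀ n : ℕ, (T ^ n) (b j) = μ j ^ n • b j := by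
      intro n
      induction n with
      | zero => simp
      | succ n ih => rw [pow_succ', Module.End.mul_apply, ih, map_smul, hμ, smul_smul, pow_succ]
    have h2 := h1 M
    rw [hT, Module.End.one_apply] at h2
    have h3 : (μ j ^ M - 1) • b j = 0 := by rw [sub_smul, ← h2, one_smul, sub_self]
    exact sub_eq_zero.1 ((smul_eq_zero.1 h3).resolve_right (b.ne_zero j))
  choose e _ he using fun j => hω.eq_pow_of_pow_eq_one (hμM j)
  exact ⟨b, e, fun j => by rw [he, hμ]⟩

end FiniteOrder

/-! ### Traces on products of matrix algebras -/

section MatrixTrace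

variable {k : Type*} [Field k]

theorem trace_mulLeft_mulRight_matrix {n : Type*} [Fintype n] [DecidableEq n]
    (P Q : Matrix n n k) :
    LinearMap.trace k (Matrix n n k) (LinearMap.mulLeft k P ∘ₗ LinearMap.mulRight k Q) =
      P.trace * Q.trace := by
  rw [LinearMap.trace_eq_matrix_trace k (Matrix.stdBasis k n n), Matrix.trace,
    Fintype.sum_prod_type, Matrix.trace, Matrix.trace, Finset.sum_mul_sum]
  refine Finset.sum_congr rfl fun i _ => Finset.sum_congr rfl fun j _ => ?_
  simp [LinearMap.toMatrix_apply, Matrix.stdBasis, Matrix.mul_apply]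
  rw [Finset.sum_eq_single i (fun a _ h => by simp [Pi.single_eq_of_ne h]) (by simp),
    Finset.sum_eq_single j (fun a _ h => by simp [Pi.single_eq_of_ne h]) (by simp)]
  simp

theorem trace_mulLeft_mulRight_pi {ι : Type*} [Fintype ι] [DecidableEq ι] {n : ι → Type*}
    [∀ i, Fintype (n i)] [∀ i, DecidableEq (n i)] (P Q : Π i, Matrix (n i) (n i) k) :
    LinearMap.trace k (Π i, Matrix (n i) (n i) k)
        (LinearMap.mulLeft k P ∘ₗ LinearMap.mulRight k Q) =
      ∑ i, (P i).trace * (Q i).trace := by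
  rw [LinearMap.trace_eq_matrix_trace k (Pi.basis fun i => Matrix.stdBasis k (n i) (n i)),
    Matrix.trace, Fintype.sum_sigma]
  refine Finset.sum_congr rfl fun i _ => ?_
  rw [← trace_mulLeft_mulRight_matrix,
    LinearMap.trace_eq_matrix_trace k (Matrix.stdBasis k (n i) (n i)), Matrix.trace]
  refine Finset.sum_congr rfl fun j _ => ?_
  simp [LinearMap.toMatrix_apply]

/-- A one-dimensional representation of a product of matrix algebras lives on a factor of
size one. -/
theorem exists_eq_one_of_algHom_pi_matrix {ι : Type*} [Fintype ι] [DecidableEq ι] {n : ι → ℕ}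
    (hn : ∀ i, NeZero (n i)) (χ : (Π i, Matrix (Fin (n i)) (Fin (n i)) k) →ₐ[k] k) :
    ∃ i, n i = 1 := by
  have h1 : ∑ i, χ (Pi.single i 1) = 1 := by
    have h := Finset.univ_sum_single (1 : Π i, Matrix (Fin (n i)) (Fin (n i)) k)
    simp only [Pi.one_apply] at h
    rw [← map_sum, h, map_one]
  obtain ⟨i, hi⟩ : ∃ i, χ (Pi.single i 1) ≠ 0 := by
    by_contra! h
    simp [h] at h1
  have hi1 : χ (Pi.single i 1) = 1 := by
    have : χ (Pi.single i 1) * χ (Pi.single i 1) = χ (Pi.single i 1) := by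
      rw [← map_mul, ← Pi.single_mul, one_mul]
    exact mul_right_cancel₀ hi (by rw [this, one_mul])
  have := hn i
  let f : Matrix (Fin (n i)) (Fin (n i)) k →+* k :=
    { toFun := fun X => χ (Pi.single i X)
      map_one' := hi1
      map_zero' := by simp
      map_mul' := fun X Y => by rw [← map_mul, ← Pi.single_mul]
      map_add' := fun X Y => by rw [← map_add, ← Pi.single_add] }
  refine ⟨i, ?_⟩
  by_contra hne
  have hlt : 1 < n i := by have := NeZero.ne (n i); omega
  let a : Fin (n i) := ⟨0, by omega⟩
  let b : Fin (n i) := ⟨1, hlt⟩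
  have hz : Matrix.single a b (1 : k) = 0 := by
    apply f.injective
    have : f (Matrix.single a b 1) * f (Matrix.single a b 1) = 0 := by
      have hba : b ≠ a := by simp [a, b]
      rw [← map_mul, Matrix.single_mul_single_of_ne _ _ _ _ hba, map_zero]
    rw [mul_self_eq_zero.1 this, map_zero]
  have := congrFun (congrFun hz a) b
  simp at this

end MatrixTrace

/-! ### Conjugations whose trace is divisible by the dimension -/

section Cyclotomic

variable {k : Type*} [Field k] [IsAlgClosed k] [CharZero k]

/-- If a power of the invertible matrix `G` is scalar, then `tr(G) tr(G⁻¹)` comes from a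
cyclotomic field and is a squared absolute value under every complex embedding. -/
theorem exists_trace_mul_trace_eq {n M : ℕ} [NeZero M] {K : Type*} [Field K] {ζ : K}
    (hζ : IsPrimitiveRoot ζ M) (ι : K →+* k) {G G' : Matrix (Fin n) (Fin n) k} (hG : G * G' = 1)
    {c : k} (hc : G ^ M = algebraMap k _ c) :
    ∃ w w' : K, G.trace * G'.trace = ι (w * w') ∧
      ∀ φ : K →+* ℂ, φ w' = (starRingEnd ℂ) (φ w) := by
  have hG' : G' * G = 1 := mul_eq_one_comm.1 hG
  obtain ⟨r, hr⟩ := IsAlgClosed.exists_pow_nat_eq c (NeZero.pos M)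
  -- if `c = 0` then `G` is nilpotent and invertible, so that `n = 0`
  by_cases hr0 : r = 0
  · have h0 : G ^ M = 0 := by rw [hc, ← hr, hr0, zero_pow (NeZero.ne M), map_zero]
    have h1 : (1 : Matrix (Fin n) (Fin n) k) = 0 := by
      rw [← one_pow M, ← hG, (show Commute G G' from hG.trans hG'.symm).mul_pow, h0, zero_mul]
    refine ⟨0, 0, ?_, by simp⟩
    rw [← mul_one G, h1]
    simp
  have hω : IsPrimitiveRoot (ι ζ) M := hζ.map_of_injective ι.injective
  -- after rescaling, the eigenvalues of `G` are `M`-th roots of unity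
  have hT : (Matrix.toLin' (r⁻¹ • G)) ^ M = 1 := by
    rw [← Matrix.toLin'_pow, smul_pow, hc, ← hr, Algebra.algebraMap_eq_smul_one, smul_smul,
      ← mul_pow, inv_mul_cancel₀ hr0, one_pow, one_smul, Matrix.toLin'_one]
    rfl
  obtain ⟨b, e, hb⟩ := exists_eigenbasis_of_pow_eq_one hω hT
  have hζ0 : ζ ≠ 0 := hζ.ne_zero (NeZero.ne M)
  refine ⟨∑ j, ζ ^ e j, ∑ j, (ζ ^ e j)⁻¹, ?_, fun φ => ?_⟩
  · have h1 : (r⁻¹ • G).trace = ∑ j, ι ζ ^ e j := by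
      rw [← Matrix.trace_toLin'_eq, trace_eq_sum_of_eigenbasis b _ _ hb]
    have h2 : (r • G').trace = ∑ j, (ι ζ ^ e j)⁻¹ := by
      rw [← Matrix.trace_toLin'_eq]
      refine trace_eq_sum_of_eigenbasis b _ _ fun j => ?_
      have hne : ι ζ ^ e j ≠ 0 := pow_ne_zero _ (hω.ne_zero (NeZero.ne M))
      have h3 : Matrix.toLin' (r • G') (Matrix.toLin' (r⁻¹ • G) (b j)) = b j := by
        rw [← Matrix.toLin'_mul_apply, smul_mul_smul_comm, mul_inv_cancel₀ hr0, hG', one_smul,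
          Matrix.toLin'_one, LinearMap.id_apply]
      rw [hb, map_smul] at h3
      conv_rhs => rw [← h3]
      rw [smul_smul, inv_mul_cancel₀ hne, one_smul]
    rw [Matrix.trace_smul, smul_eq_mul] at h1 h2
    have h3 : G.trace * G'.trace = (r⁻¹ * G.trace) * (r * G'.trace) := by field_simp
    rw [h3, h1, h2]
    simp
  · have hn : ‖φ ζ‖ = 1 := Complex.norm_eq_one_of_pow_eq_one
      (by rw [← map_pow, hζ.pow_eq_one, map_one]) (NeZero.ne M)
    simp [← Complex.inv_eq_conj hn]

/-- Conjugation `T` by an element of finite order modulo the center of a semisimple algebra with a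
one-dimensional representation is trivial as soon as `Tr(T)` is `dim A` times an algebraic
integer: by positivity `0 < φ(Tr T) ≤ dim A` for every complex embedding `φ`, so that
`Tr(T) = dim A` by Kronecker's theorem on algebraic integers. -/
theorem eq_one_of_trace_conj {A : Type*} [Ring A] [Algebra k A] [Module.Finite k A]
    [IsSemisimpleRing A] (χ : A →ₐ[k] k) {g g' : A} (hg : g * g' = 1) (hg' : g' * g = 1)
    {T : Module.End k A} (hconj : ∀ x, T x = g * x * g') {M : ℕ} [NeZero M] (hT : T ^ M = 1)
    {K : Type*} [Field K] [NumberField K] {ζ : K} (hζ : IsPrimitiveRoot ζ M) (ι : K →+* k)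
    {q : k} (hq : IsIntegral ℤ q) (hTq : LinearMap.trace k A T = Module.finrank k A * q) :
    T = 1 := by
  classical
  have hι : Function.Injective ι := ι.injective
  have hnt : Nontrivial A := ⟨⟨1, 0, fun h => one_ne_zero (α := k) (by
    rw [← map_one χ, h, map_zero])⟩⟩
  set d := Module.finrank k A with hd
  have hd0 : 0 < d := Module.finrank_pos
  -- the trace of `T` as a sum of squared absolute values
  obtain ⟨r, n, hn, ⟨e⟩⟩ := IsSemisimpleRing.exists_algEquiv_pi_matrix_of_isAlgClosed k A
  have htr : LinearMap.trace k A T = ∑ i, (e g i).trace * (e g' i).trace := by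
    rw [← trace_mulLeft_mulRight_pi, ← LinearMap.trace_conj' T e.toLinearEquiv]
    congr 1
    refine LinearMap.ext fun x => ?_
    obtain ⟨x, rfl⟩ := e.surjective x
    change e (T (e.symm (e x))) = _
    rw [e.symm_apply_apply, hconj]
    simp [mul_assoc]
  have hpow : ∀ (m : ℕ) (x : A), (T ^ m) x * g ^ m = g ^ m * x := by
    intro m
    induction m with
    | zero => simp
    | succ m ih =>
      intro x
      rw [pow_succ' T, Module.End.mul_apply, hconj, pow_succ' g, mul_assoc, ← mul_assoc g',
        hg', one_mul, mul_assoc, ih, mul_assoc]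
  have hcen : ∀ i, ∃ c : k, (e g i) ^ M = algebraMap k _ c := by
    intro i
    have hcomm : ∀ X : Matrix (Fin (n i)) (Fin (n i)) k, Commute X ((e g i) ^ M) := by
      intro X
      have h1 := congrArg e (hpow M (e.symm (Pi.single i X)))
      rw [hT, Module.End.one_apply, map_mul, map_mul, e.apply_symm_apply, map_pow] at h1
      have h2 := congrFun h1 i
      simp only [Pi.mul_apply, Pi.single_eq_same, Pi.pow_apply] at h2
      exact h2
    obtain ⟨c, hc⟩ := Matrix.mem_range_scalar_of_commute_single
      (fun a b _ => hcomm (Matrix.single a b 1))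
    exact ⟨c, hc.symm⟩
  choose c hc using hcen
  have hgi : ∀ i, e g i * e g' i = 1 := fun i => by
    rw [← Pi.mul_apply, ← map_mul, hg, map_one, Pi.one_apply]
  choose w w' hw hw' using fun i => exists_trace_mul_trace_eq hζ ι (hgi i) (hc i)
  have hz1 : LinearMap.trace k A T = ι (∑ i, w i * w' i) := by
    rw [htr, map_sum]
    exact Finset.sum_congr rfl fun i _ => hw i
  -- the trace of `T` as a sum of roots of unity
  obtain ⟨b, f, hb⟩ := exists_eigenbasis_of_pow_eq_one (hζ.map_of_injective hι) hT
  have hz2 : LinearMap.trace k A T = ι (∑ j, ζ ^ f j) := by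
    rw [trace_eq_sum_of_eigenbasis b _ _ hb]
    simp
  have hz : ∑ i, w i * w' i = ∑ j, ζ ^ f j := hι (hz1.symm.trans hz2)
  have hnorm : ∀ φ : K →+* ℂ, ‖φ ζ‖ = 1 := fun φ => Complex.norm_eq_one_of_pow_eq_one
    (by rw [← map_pow, hζ.pow_eq_one, map_one]) (NeZero.ne M)
  have hsq : ∀ φ : K →+* ℂ, φ (∑ j, ζ ^ f j) = ((∑ i, Complex.normSq (φ (w i)) : ℝ) : ℂ) := by
    intro φ
    rw [← hz]
    simp [hw', Complex.mul_conj]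
  have hdK : (d : K) ≠ 0 := Nat.cast_ne_zero.2 hd0.ne'
  set u : K := (∑ j, ζ ^ f j) / d with hu
  have hιu : ι u = q := by
    have hdk : (d : k) ≠ 0 := Nat.cast_ne_zero.2 hd0.ne'
    rw [hu, map_div₀, ← hz2, hTq, map_natCast, mul_div_cancel_left₀ _ hdk]
  have hu_int : IsIntegral ℤ u := by
    rw [← hιu] at hq
    exact (isIntegral_algHom_iff (ι.toIntAlgHom) hι).1 hq
  have hφu : ∀ φ : K →+* ℂ, φ u = (((∑ i, Complex.normSq (φ (w i))) / d : ℝ) : ℂ) := by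
    intro φ
    rw [hu, map_div₀, hsq, map_natCast]
    push_cast
    rfl
  have hu_le : ∀ φ : K →+* ℂ, ‖φ u‖ ≤ 1 := by
    intro φ
    rw [hu, map_div₀, map_natCast, norm_div, Complex.norm_natCast,
      div_le_one (by exact_mod_cast hd0), map_sum]
    refine (norm_sum_le _ _).trans ?_
    simp [hnorm, ← hd]
  -- the summand of a block of size one is `1`
  have hu0 : u ≠ 0 := by
    obtain ⟨i, hi⟩ := exists_eq_one_of_algHom_pi_matrix hn (χ.comp e.symm.toAlgHom)
    have htr1 : (e g i).trace * (e g' i).trace = 1 := by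
      have h1 := congrArg Matrix.trace (hgi i)
      have h2 : ∀ {m : ℕ} (_ : m = 1) (P Q : Matrix (Fin m) (Fin m) k), (P * Q).trace =
          P.trace * Q.trace := by
        rintro _ rfl P Q
        simp [Matrix.trace_fin_one, Matrix.mul_apply]
      rw [h2 hi] at h1
      rw [h1, Matrix.trace_one, Fintype.card_fin, hi, Nat.cast_one]
    have hwi : w i ≠ 0 := by
      intro h0
      have := hw i
      rw [htr1, h0, zero_mul, map_zero] at this
      exact one_ne_zero this
    obtain ⟨φ⟩ : Nonempty (K →+* ℂ) := inferInstance
    intro h0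
    have h1 := hsq φ
    have h2 : (∑ j, ζ ^ f j) = 0 := by
      rw [hu, div_eq_zero_iff] at h0
      exact h0.resolve_right hdK
    rw [h2, map_zero, eq_comm, Complex.ofReal_eq_zero,
      Finset.sum_eq_zero_iff_of_nonneg fun i _ => Complex.normSq_nonneg _] at h1
    have h3 := h1 i (Finset.mem_univ i)
    rw [map_eq_zero, map_eq_zero] at h3
    exact hwi h3
  obtain ⟨m, hm, hum⟩ := NumberField.Embeddings.pow_eq_one_of_norm_le_one K ℂ hu0 hu_int hu_le
  obtain ⟨φ⟩ : Nonempty (K →+* ℂ) := inferInstance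
  have hφ1 : ‖φ u‖ = 1 := Complex.norm_eq_one_of_pow_eq_one
    (by rw [← map_pow, hum, map_one]) hm.ne'
  -- `φ u` is a nonnegative real root of unity, so that `Tr(T) = d` is a sum of `d` roots of unity
  have hre : ∑ j, (φ ζ ^ f j).re = d := by
    have h1 := hφu φ
    have h2 : 0 ≤ (∑ i, Complex.normSq (φ (w i))) / (d : ℝ) :=
      div_nonneg (Finset.sum_nonneg fun i _ => Complex.normSq_nonneg _) (Nat.cast_nonneg d)
    rw [h1, Complex.norm_real, Real.norm_of_nonneg h2,
      div_eq_one_iff_eq (by exact_mod_cast hd0.ne')] at hφ1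
    have h3 := congrArg Complex.re (hsq φ)
    rw [hφ1] at h3
    simpa using h3
  have hone : ∀ j, φ ζ ^ f j = 1 := by
    have hle : ∀ j ∈ Finset.univ, (φ ζ ^ f j).re ≤ 1 := fun j _ =>
      (Complex.re_le_norm _).trans (by simp [hnorm])
    have hall := (Finset.sum_eq_sum_iff_of_le hle).1 (by rw [hre]; simp [← hd])
    intro j
    have h1 := hall j (Finset.mem_univ j)
    have h2 : ‖φ ζ ^ f j‖ = 1 := by simp [hnorm]
    have h3 := Complex.sq_norm_sub_sq_re (φ ζ ^ f j)
    rw [h1, h2, sub_self, eq_comm, sq_eq_zero_iff] at h3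
    exact Complex.ext h1 h3
  refine b.ext fun j => ?_
  have h1 : ζ ^ f j = 1 := φ.injective (by rw [map_pow, hone, map_one])
  rw [hb, ← map_pow, h1, map_one, one_smul, Module.End.one_apply]

end Cyclotomic

/-! ### The antipode of a semisimple Hopf algebra -/

section Semiprime

/-- A semisimple ring is semiprime. -/
theorem eq_zero_of_forall_mul_mul_eq_zero {A : Type*} [Ring A] [IsSemisimpleRing A] {u : A}
    (h : ∀ a, u * a * u = 0) : u = 0 := by
  obtain ⟨e, he, hI⟩ := IsSemisimpleRing.ideal_eq_span_idempotent (Ideal.span {u})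
  obtain ⟨y, hy⟩ := Ideal.mem_span_singleton'.1 (hI ▸ Ideal.mem_span_singleton_self e)
  have h3 : e = 0 := by
    rw [← he.eq, ← hy, mul_assoc, ← mul_assoc u, h, mul_zero]
  have h4 : u ∈ Ideal.span {e} := hI ▸ Ideal.mem_span_singleton_self u
  simpa [h3] using h4

end Semiprime

section TraceForm

variable {k A : Type*} [Field k] [CharZero k] [Ring A] [Algebra k A] [Module.Finite k A]
  [IsSemisimpleRing A]

/-- The trace form of the regular representation of a semisimple algebra in characteristic zero
is nondegenerate. -/
theorem eq_zero_of_trace_mul_eq_zero {x : A}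
    (h : ∀ y, moduleCharacter k A A (y * x) = 0) : x = 0 := by
  obtain ⟨e, he, hI⟩ := IsSemisimpleRing.ideal_eq_span_idempotent (Ideal.span {x})
  obtain ⟨y, hy⟩ := Ideal.mem_span_singleton'.1 (hI ▸ Ideal.mem_span_singleton_self e)
  have h1 : IsIdempotentElem (Algebra.lmul k A e) := by
    rw [IsIdempotentElem, ← map_mul, he]
  have h2 : Algebra.lmul k A e = 0 := (LinearMap.IsIdempotentElem.trace_eq_zero_iff h1).1 (by
    have := h y
    rwa [hy] at this)
  have h3 : e = 0 := by simpa using LinearMap.congr_fun h2 1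
  have h4 : x ∈ Ideal.span {e} := hI ▸ Ideal.mem_span_singleton_self x
  simpa [h3] using h4

theorem exists_forall_eq_trace_mul (p : A →ₗ[k] k) :
    ∃ u : A, ∀ x, p x = moduleCharacter k A A (x * u) := by
  let B : A →ₗ[k] A →ₗ[k] k := (LinearMap.mul k A).flip.compr₂ (moduleCharacter k A A)
  have hB : Function.Injective B := by
    refine (injective_iff_map_eq_zero B).2 fun x hx => ?_
    exact eq_zero_of_trace_mul_eq_zero fun y => LinearMap.congr_fun hx y
  obtain ⟨u, hu⟩ := (LinearMap.injective_iff_surjective_of_finrank_eq_finrank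
    Subspace.dual_finrank_eq.symm).1 hB p
  exact ⟨u, fun x => (LinearMap.congr_fun hu x).symm⟩

end TraceForm

section Semisimple

variable {k H : Type*} [Field k] [Ring H] [HopfAlgebra k H]

/-- In a semisimple Hopf algebra a left integral on which `ε` vanishes is zero, because it
generates a left ideal of square zero. -/
theorem eq_zero_of_mul_eq_counit_smul [IsSemisimpleRing H] {u : H}
    (hu : ∀ h : H, h * u = counit (R := k) h • u)
    (hε : counit (R := k) u = 0) : u = 0 := by
  refine eq_zero_of_forall_mul_mul_eq_zero fun a => ?_
  rw [hu, Bialgebra.counit_mul, hε, zero_mul, zero_smul]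

variable [Module.Finite k H]

theorem IsHaarIntegral.exists_isDualIntegral {Λ : H} (hΛ : IsHaarIntegral k Λ) :
    ∃ lam : H →ₗ[k] k, IsDualIntegral Λ lam :=
  hΛ.exists_leftHitL_eq 1

theorem IsHaarIntegral.finrank_ne_zero [CharZero k] {Λ : H} (hΛ : IsHaarIntegral k Λ) :
    (Module.finrank k H : k) ≠ 0 := by
  have : Nontrivial H := ⟨⟨Λ, 0, fun h => one_ne_zero (α := k) (by
    rw [← hΛ.counit_eq_one, h, map_zero])⟩⟩
  exact Nat.cast_ne_zero.2 Module.finrank_pos.ne'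

variable [IsSemisimpleRing H]

theorem IsNormalizedIntegral.isHaarIntegral {Λ : H} (hΛ : IsNormalizedIntegral k Λ) :
    IsHaarIntegral k Λ := by
  have hr : ∀ h : H, Λ * h = counit (R := k) h • Λ := fun h => by
    rw [← sub_eq_zero]
    refine eq_zero_of_mul_eq_counit_smul (k := k) (fun x => ?_) ?_
    · rw [mul_sub, ← mul_assoc, hΛ.left_integral, mul_smul_comm, hΛ.left_integral, smul_mul_assoc,
        smul_sub, smul_comm]
    · rw [map_sub, Bialgebra.counit_mul, map_smul, smul_eq_mul, mul_comm, sub_self]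
  refine ⟨hΛ.left_integral, hr, ?_⟩
  have h1 : (Algebra.lsmul k k H Λ : Module.End k H) = (counit (R := k) (A := H)).smulRight Λ :=
    LinearMap.ext fun h => hr h
  have h2 := hΛ.normalized
  rw [moduleCharacter, LinearMap.comp_apply, AlgHom.toLinearMap_apply, h1,
    LinearMap.trace_smulRight] at h2
  exact h2

/-- `S²` is inner: it transports the symmetric trace form of the regular representation to the
form of the dual integral. -/
theorem IsDualIntegral.exists_antipode_sq_eq_conj [CharZero k] {Λ : H} {lam : H →ₗ[k] k}
    (hl : IsDualIntegral Λ lam) (hΛ : IsHaarIntegral k Λ) :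
    ∃ g g' : H, g * g' = 1 ∧ g' * g = 1 ∧ ∀ x, antipode k (antipode k x) = g * x * g' := by
  obtain ⟨u, hu⟩ := exists_forall_eq_trace_mul lam
  have hc : ∀ x y : H, moduleCharacter k H H (x * y) = moduleCharacter k H H (y * x) := by
    intro x y
    simp only [moduleCharacter, LinearMap.comp_apply, AlgHom.toLinearMap_apply, map_mul]
    exact LinearMap.trace_mul_comm k _ _
  have hinj : Function.Injective (LinearMap.mulRight k u) := by
    refine (injective_iff_map_eq_zero _).2 fun h hh => ?_
    rw [LinearMap.mulRight_apply] at hh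
    obtain ⟨h, rfl⟩ := LinearMap.injective_iff_surjective.1 (hl.antipode_injective hΛ) h
    have h0 : lam ∘ₗ LinearMap.mulRight k (antipode k h) = 0 := by
      ext x
      simp [hu, mul_assoc, hh]
    rw [← hl.leftHitL_mulRight_antipode hΛ h, h0]
    simp
  obtain ⟨g, hg⟩ := LinearMap.injective_iff_surjective.1 hinj 1
  rw [LinearMap.mulRight_apply] at hg
  have hg' : u * g = 1 := hinj (by simp [mul_assoc, hg])
  refine ⟨u, g, hg', hg, fun x => ?_⟩
  have h1 : u * x = antipode k (antipode k x) * u := by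
    rw [← sub_eq_zero]
    refine eq_zero_of_trace_mul_eq_zero (k := k) fun y => ?_
    have h2 := hl.apply_mul_comm hΛ x y
    rw [hu, hu, mul_assoc, hc] at h2
    rw [mul_sub, map_sub, ← mul_assoc, ← mul_assoc, h2, sub_self]
  rw [h1, mul_assoc, hg', mul_one]

/-- A semisimple Hopf algebra over an algebraically closed field of characteristic zero has an
involutive antipode (Larson and Radford). -/
theorem antipode_antipode_of_isHaarIntegral [IsAlgClosed k] [CharZero k] {Λ : H}
    (hΛ : IsHaarIntegral k Λ) (h : H) : antipode k (antipode k h) = h := by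
  obtain ⟨lam, hl⟩ := hΛ.exists_isDualIntegral
  obtain ⟨g, g', hg, hg', hc⟩ := hl.exists_antipode_sq_eq_conj hΛ
  obtain ⟨M, hM, hT⟩ := hl.exists_antipode_iterate_eq hΛ
  have : NeZero M := ⟨hM.ne'⟩
  obtain ⟨Q, hQ, htr⟩ := hl.exists_trace_eq hΛ hΛ.finrank_ne_zero hT
  let ι : CyclotomicField M ℚ →ₐ[ℚ] k := IsAlgClosed.lift
  obtain ⟨ζ, hζ⟩ := (CyclotomicField.isCyclotomicExtension M ℚ).exists_isPrimitiveRoot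
    (Set.mem_singleton M) hM.ne'
  have := eq_one_of_trace_conj (Bialgebra.counitAlgHom k H) hg hg'
    (T := antipode k ∘ₗ antipode k) hc hT
    hζ (ι : CyclotomicField M ℚ →+* k) (isIntegral_trace_of_pow_succ_eq hM hQ) htr
  exact LinearMap.congr_fun this h

section Involutive

variable [IsAlgClosed k] [CharZero k] {Λ : H}

/-- The operator `h ↦ h ↼ p` is the transpose of left multiplication by `p` on `H^*`, so that
`d Λ` is the regular character of `H^*`. -/
theorem IsHaarIntegral.trace_rightHitL (hΛ : IsHaarIntegral k Λ) (p : H →ₗ[k] k) :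
    LinearMap.trace k H (rightHitL p) = Module.finrank k H * p Λ := by
  obtain ⟨lam, hl⟩ := hΛ.exists_isDualIntegral
  exact hl.trace_rightHitL hΛ (antipode_antipode_of_isHaarIntegral hΛ) p

/-- A symmetric form `p` gives a central element `Λ ↼ p`, because `S² = 1`. -/
theorem IsHaarIntegral.rightHitL_mem_center (hΛ : IsHaarIntegral k Λ) {p : H →ₗ[k] k}
    (hp : ∀ x y, p (x * y) = p (y * x)) : rightHitL p Λ ∈ Subalgebra.center k H := by
  have hS := antipode_antipode_of_isHaarIntegral hΛ
  rw [Subalgebra.mem_center_iff]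
  intro x
  have h1 : p ∘ₗ LinearMap.mulLeft k (antipode k x) = p ∘ₗ LinearMap.mulRight k (antipode k x) :=
    LinearMap.ext fun y => hp _ _
  rw [hΛ.mul_rightHitL, h1, ← hΛ.rightHitL_mul_antipode, hS]

end Involutive

end Semisimple

/-! ### Blocks and primitive idempotents of a semisimple algebra -/

section SemisimpleRing

variable {A : Type*} [Ring A] [IsSemisimpleRing A]

/-- A two-sided ideal of a semisimple ring is generated by a central idempotent. -/
theorem exists_central_idempotent (J : Ideal A) (hJ : ∀ y ∈ J, ∀ x, y * x ∈ J) :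
    ∃ e ∈ J, IsIdempotentElem e ∧ e ∈ Subring.center A ∧ ∀ y ∈ J, y * e = y := by
  obtain ⟨e, he, rfl⟩ := IsSemisimpleRing.ideal_eq_span_idempotent J
  have hmem : e ∈ Ideal.span {e} := Ideal.mem_span_singleton_self e
  have hr : ∀ y ∈ Ideal.span {e}, y * e = y := by
    intro y hy
    obtain ⟨a, rfl⟩ := Ideal.mem_span_singleton'.1 hy
    rw [mul_assoc, he]
  refine ⟨e, hmem, he, Subring.mem_center_iff.2 fun x => ?_, hr⟩
  have h1 : e * x * e = e * x := hr _ (hJ _ hmem x)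
  have h2 : x * e - e * x * e = 0 := by
    have hy : x * e - e * x * e ∈ Ideal.span {e} :=
      Ideal.sub_mem _ (Ideal.mul_mem_left _ _ hmem) (Ideal.mul_mem_left _ _ hmem)
    have hey : e * (x * e - e * x * e) = 0 := by
      simp only [mul_sub, ← mul_assoc, he.eq, sub_self]
    refine eq_zero_of_forall_mul_mul_eq_zero fun a => ?_
    rw [← hr _ (hJ _ hy a), mul_assoc, hey, mul_zero]
  rw [← h1, ← sub_eq_zero, h2]

theorem IsPrimitiveIdempotent.isAtom_rightIdeal {f : A} (hf : IsPrimitiveIdempotent f) :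
    IsAtom (rightIdeal f) := by
  have hff : f ∈ rightIdeal f := (mem_rightIdeal f f).2 ⟨1, mul_one f⟩
  have hl : ∀ y ∈ rightIdeal f, f * y = y := by
    intro y hy
    obtain ⟨x, rfl⟩ := (mem_rightIdeal f y).1 hy
    rw [← mul_assoc, hf.idem]
  have hmul : ∀ (N : Submodule Aᵐᵒᵖ A), ∀ y ∈ N, ∀ x, y * x ∈ N := fun N y hy x =>
    N.smul_mem (MulOpposite.op x) hy
  refine ⟨fun h => hf.ne_zero ((Submodule.mem_bot _).1 (h ▸ hff)), fun N hN => ?_⟩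
  obtain ⟨N', hc⟩ := exists_isCompl N
  obtain ⟨a, ha, b, hb, hab⟩ := Submodule.mem_sup.1
    (hc.sup_eq_top.symm ▸ Submodule.mem_top : f ∈ N ⊔ N')
  have hfa : f * a = a := hl a (hN.le ha)
  have hfb : f * b = b := hl b (by
    rw [← eq_sub_iff_add_eq'] at hab
    exact hab ▸ Submodule.sub_mem _ hff (hN.le ha))
  have hdis : ∀ y ∈ N, y ∈ N' → y = 0 := fun y h1 h2 =>
    Submodule.disjoint_def.1 hc.disjoint y h1 h2
  have e1 : a * a + b * a = a := by rw [← add_mul, hab, hfa]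
  have e2 : a * b + b * b = b := by rw [← add_mul, hab, hfb]
  have hba : b * a = 0 := hdis _ (by
    rw [← eq_sub_iff_add_eq'] at e1
    exact e1 ▸ N.sub_mem ha (hmul N a ha a)) (hmul N' b hb a)
  have hab0 : a * b = 0 := hdis _ (hmul N a ha b) (by
    rw [← eq_sub_iff_add_eq] at e2
    exact e2 ▸ N'.sub_mem hb (hmul N' b hb b))
  rw [hba, add_zero] at e1
  rw [hab0, zero_add] at e2
  rcases hf.indecomposable a b e1 e2 hab0 hba hab with h0 | h0
  · rw [h0, zero_add] at hab
    refine (Submodule.eq_bot_iff _).2 fun y hy => hdis y hy ?_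
    rw [← hl y (hN.le hy), ← hab]
    exact hmul N' b hb y
  · rw [h0, add_zero] at hab
    refine absurd (fun y hy => ?_) hN.not_ge
    rw [← hl y hy, ← hab]
    exact hmul N a ha y

theorem IsPrimitiveIdempotent.isSimpleModule_rightIdeal {f : A} (hf : IsPrimitiveIdempotent f) :
    IsSimpleModule Aᵐᵒᵖ (rightIdeal f) :=
  isSimpleModule_iff_isAtom.2 hf.isAtom_rightIdeal

/-- A block contains the two-sided ideal `A f A` of each of its primitive idempotents as a direct
factor, so that it coincides with it. -/
theorem IsCentralPrimitiveIdempotent.mem_span {F f : A} (hF : IsCentralPrimitiveIdempotent F)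
    (hf : f ≠ 0) (hfF : f * F = f) : F ∈ Ideal.span (Set.range fun b => f * b) := by
  set J := Ideal.span (Set.range fun b => f * b)
  have hJ : ∀ y ∈ J, ∀ x, y * x ∈ J := by
    intro y hy x
    induction hy using Submodule.span_induction with
    | mem y hy =>
      obtain ⟨b, rfl⟩ := hy
      exact Ideal.subset_span ⟨b * x, (mul_assoc f b x).symm⟩
    | zero => simp
    | add y z _ _ hy hz => rw [add_mul]; exact J.add_mem hy hz
    | smul a y _ hy => rw [smul_eq_mul, mul_assoc]; exact J.mul_mem_left a hy
  obtain ⟨e, heJ, he, hec, hr⟩ := exists_central_idempotent J hJ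
  have hFe : Commute F e := (Subring.mem_center_iff.1 hec F)
  have hfJ : f ∈ J := Ideal.subset_span ⟨1, mul_one f⟩
  have h1e : (1 - e) ∈ Subring.center A := Subring.sub_mem _ (Subring.one_mem _) hec
  rcases hF.indecomposable (F * e) (F * (1 - e)) (Subring.mul_mem _ hF.central hec)
    (Subring.mul_mem _ hF.central h1e) (hF.idem.mul_of_commute hFe he)
    (hF.idem.mul_of_commute ((Commute.one_right F).sub_right hFe) he.one_sub)
    (by rw [hFe.eq, mul_assoc, ← mul_assoc F, hF.idem.eq, mul_sub, mul_one, hFe.eq, mul_sub,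
      ← mul_assoc, he.eq, sub_self])
    (by rw [← mul_add, add_sub_cancel, mul_one]) with h | h
  · refine absurd ?_ hf
    rw [← hr f hfJ, ← hfF, mul_assoc, h, mul_zero]
  · rw [mul_sub, mul_one, sub_eq_zero] at h
    rw [h]
    exact J.mul_mem_left F heJ

end SemisimpleRing

section Trace

variable {k V : Type*} [Field k] [AddCommGroup V] [Module k V] [Module.Finite k V]

theorem trace_eq_finrank_range {P : Module.End k V} (hP : IsIdempotentElem P) :
    LinearMap.trace k V P = Module.finrank k (LinearMap.range P) :=
  ((LinearMap.isProj_range_iff_isIdempotentElem P).2 hP).trace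

theorem trace_eq_one_of_isProj_span {P : Module.End k V} {v : V} (hv : v ≠ 0)
    (hP : LinearMap.IsProj (Submodule.span k {v}) P) : LinearMap.trace k V P = 1 := by
  rw [hP.trace, finrank_span_singleton hv, Nat.cast_one]

end Trace

section BlockCharacter

variable {k A : Type*} [Field k] [Ring A] [Algebra k A]

/-- The character of the right module `f A` as a linear form. -/
noncomputable def blockCharacter (k : Type*) {A : Type*} [Field k] [Ring A] [Algebra k A] (f : A) :
    A →ₗ[k] k :=
  moduleCharacter k Aᵐᵒᵖ (rightIdeal f) ∘ₗ (MulOpposite.opLinearEquiv k).toLinearMap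

theorem blockCharacter_apply (f x : A) : blockCharacter k f x = rightIdealCharacter k f x := rfl

theorem blockCharacter_mul_comm (f x y : A) :
    blockCharacter k f (x * y) = blockCharacter k f (y * x) := by
  change moduleCharacter k Aᵐᵒᵖ _ (MulOpposite.op (x * y)) =
    moduleCharacter k Aᵐᵒᵖ _ (MulOpposite.op (y * x))
  simp only [moduleCharacter, LinearMap.comp_apply, AlgHom.toLinearMap_apply, MulOpposite.op_mul,
    map_mul]
  exact LinearMap.trace_mul_comm k _ _

theorem blockCharacter_mul_left {F f : A} (hF : F ∈ Subring.center A) (hfF : f * F = f) (x : A) :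
    blockCharacter k f (F * x) = blockCharacter k f x := by
  change LinearMap.trace k _ (Algebra.lsmul k k (rightIdeal f) (MulOpposite.op (F * x))) =
    LinearMap.trace k _ (Algebra.lsmul k k (rightIdeal f) (MulOpposite.op x))
  congr 1
  ext ⟨y, hy⟩
  obtain ⟨a, rfl⟩ := (mem_rightIdeal f y).1 hy
  change f * a * (F * x) = f * a * x
  rw [← mul_assoc, mul_assoc f, Subring.mem_center_iff.1 hF a, ← mul_assoc f, hfF]

variable [Module.Finite k A]

instance finite_rightIdeal (f : A) : Module.Finite k (rightIdeal f) :=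
  Module.Finite.of_injective ((rightIdeal f).subtype.restrictScalars k) Subtype.val_injective

theorem blockCharacter_one (f : A) :
    blockCharacter k f 1 = Module.finrank k (rightIdeal f) := by
  change moduleCharacter k Aᵐᵒᵖ _ (MulOpposite.op 1) = _
  simp only [moduleCharacter, LinearMap.comp_apply, AlgHom.toLinearMap_apply, MulOpposite.op_one,
    map_one, LinearMap.trace_one]

theorem exists_nat_eq_blockCharacter (f : A) {g : A} (hg : IsIdempotentElem g) :
    ∃ n : ℕ, blockCharacter k f g = n := by
  let P : Module.End k (rightIdeal f) := Algebra.lsmul k k (rightIdeal f) (MulOpposite.op g)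
  have hP : IsIdempotentElem P := by
    rw [IsIdempotentElem, ← map_mul, ← MulOpposite.op_mul, hg]
  exact ⟨_, trace_eq_finrank_range hP⟩

variable [IsAlgClosed k] [IsSemisimpleRing A]

/-- `f A f = k f`, by Schur's lemma for the simple module `f A`. -/
theorem IsPrimitiveIdempotent.exists_mul_mul_eq_smul {f : A} (hf : IsPrimitiveIdempotent f)
    (x : A) : ∃ c : k, f * x * f = c • f := by
  have := hf.isSimpleModule_rightIdeal
  let L : Module.End Aᵐᵒᵖ (rightIdeal f) :=
    { toFun := fun y => ⟨f * x * y, (mem_rightIdeal f _).2 ⟨x * y, (mul_assoc _ _ _).symm⟩⟩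
      map_add' := fun y z => Subtype.ext (mul_add _ _ _)
      map_smul' := fun a y => Subtype.ext (mul_assoc (f * x) (y : A) a.unop).symm }
  obtain ⟨c, hc⟩ := (IsSimpleModule.algebraMap_end_bijective_of_isAlgClosed (A := Aᵐᵒᵖ)
    (V := rightIdeal f) k).2 L
  refine ⟨c, ?_⟩
  have h := congrArg Subtype.val
    (LinearMap.congr_fun hc ⟨f, (mem_rightIdeal f f).2 ⟨1, mul_one f⟩⟩)
  exact h.symm

theorem IsPrimitiveIdempotent.blockCharacter_self {f : A} (hf : IsPrimitiveIdempotent f) :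
    blockCharacter k f f = 1 := by
  let v : rightIdeal f := ⟨f, (mem_rightIdeal f f).2 ⟨1, mul_one f⟩⟩
  have hv : v ≠ 0 := fun h => hf.ne_zero (congrArg Subtype.val h)
  have hP : LinearMap.IsProj (Submodule.span k {v})
      (Algebra.lsmul k k (rightIdeal f) (MulOpposite.op f) : Module.End k (rightIdeal f)) := by
    refine ⟨fun ⟨y, hy⟩ => ?_, fun y hy => ?_⟩
    · obtain ⟨a, rfl⟩ := (mem_rightIdeal f y).1 hy
      obtain ⟨c, hc⟩ := hf.exists_mul_mul_eq_smul (k := k) a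
      exact Submodule.mem_span_singleton.2 ⟨c, Subtype.ext hc.symm⟩
    · obtain ⟨c, rfl⟩ := Submodule.mem_span_singleton.1 hy
      rw [map_smul]
      congr 1
      exact Subtype.ext hf.idem
  exact trace_eq_one_of_isProj_span hv hP

/-- Up to a scalar, the character of `f A` is the only trace form on the block of `f`,
because the block is spanned by the products `a f b` and `f A f = k f`. -/
theorem IsCentralPrimitiveIdempotent.apply_mul_eq {F f : A} (hF : IsCentralPrimitiveIdempotent F)
    (hf : IsPrimitiveIdempotent f) (hfF : f * F = f) (t : A →ₗ[k] k)
    (ht : ∀ x y, t (x * y) = t (y * x)) (x : A) :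
    t (F * x) = t f * blockCharacter k f x := by
  let s : A →ₗ[k] k := t - t f • blockCharacter k f
  have hs : ∀ x y, s (x * y) = s (y * x) := fun x y => by
    simp [s, ht x y, blockCharacter_mul_comm f x y]
  have hsf : s f = 0 := by simp [s, hf.blockCharacter_self]
  have hJ : ∀ y ∈ Ideal.span (Set.range fun b => f * b), ∀ a, s (a * y) = 0 := by
    intro y hy
    induction hy using Submodule.span_induction with
    | mem y hy =>
      obtain ⟨b, rfl⟩ := hy
      intro a
      obtain ⟨c, hc⟩ := hf.exists_mul_mul_eq_smul (k := k) (b * a)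
      have h1 : a * (f * b) = (a * f) * (f * b) := by
        rw [mul_assoc, ← mul_assoc f f, hf.idem.eq]
      rw [h1, hs, show f * b * (a * f) = f * (b * a) * f by simp only [mul_assoc], hc, map_smul,
        hsf, smul_zero]
    | zero => simp
    | add y z _ _ hy hz => intro a; rw [mul_add, map_add, hy, hz, add_zero]
    | smul r y _ hy => intro a; rw [smul_eq_mul, ← mul_assoc, hy]
  have h0 : s (F * x) = 0 := by rw [hs, hJ F (hF.mem_span hf.ne_zero hfF)]
  rw [LinearMap.sub_apply, sub_eq_zero, LinearMap.smul_apply, smul_eq_mul,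
    blockCharacter_mul_left hF.central hfF] at h0
  exact h0

/-- The number of primitive idempotents in a full system of a block is the dimension of its simple
module. -/
theorem IsFullPrimitiveSystem.card_eq_finrank [CharZero k] {F f : A}
    (hF : IsCentralPrimitiveIdempotent F) (hf : IsPrimitiveIdempotent f) (hfF : f * F = f)
    {m : ℕ} {g : Fin m → A} (hg : IsFullPrimitiveSystem F g) :
    (Module.finrank k (rightIdeal f) : k) = m := by
  have hgF : ∀ i, g i * F = g i := fun i => by
    rw [← hg.sum_eq, Finset.mul_sum, Finset.sum_eq_single i, (hg.orthogonal.idem i).eq]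
    · exact fun j _ hj => hg.orthogonal.ortho hj.symm
    · simp
  have h1 : ∀ i, blockCharacter k f (g i) = 1 := by
    intro i
    -- the values of the characters of `f A` at `g i` and of `g i A` at `f` are natural numbers with
    -- product `1`
    have e1 := hF.apply_mul_eq (hg.primitive i) (hgF i) (blockCharacter k f)
      (blockCharacter_mul_comm f) f
    rw [blockCharacter_mul_left hF.central hfF, hf.blockCharacter_self] at e1
    obtain ⟨n, hn⟩ := exists_nat_eq_blockCharacter (k := k) f (hg.orthogonal.idem i)
    obtain ⟨n', hn'⟩ := exists_nat_eq_blockCharacter (k := k) (g i) hf.idem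
    rw [hn, hn'] at e1
    have e2 : n * n' = 1 := by exact_mod_cast e1.symm
    rw [hn, Nat.eq_one_of_mul_eq_one_right e2, Nat.cast_one]
  rw [← blockCharacter_one, ← blockCharacter_mul_left hF.central hfF, mul_one, ← hg.sum_eq, map_sum]
  simp [h1]

end BlockCharacter

open DualAlgebra

universe u v

/-! ### The character algebra and the class sums -/

section CharacterAlgebra

variable {k : Type v} {H : Type u} [Field k] [Ring H] [HopfAlgebra k H]

theorem rightHit_eq_rightHitL (a : H) (p : DualAlgebra k H) :
    rightHit a p = rightHitL (toLin p) a := rfl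

theorem toLin_mul_eq_rightHitL (p q : DualAlgebra k H) (h : H) :
    toLin (p * q) h = toLin q (rightHitL (toLin p) h) :=
  (apply_rightHit h p q).symm

theorem toLin_mul_comm_of_mem {χ : DualAlgebra k H} (hχ : χ ∈ characterAlgebra k H) (x y : H) :
    toLin χ (x * y) = toLin χ (y * x) := by
  change χ ∈ Submodule.span k (irreducibleCharacters k H) at hχ
  induction hχ using Submodule.span_induction with
  | mem χ h =>
    obtain ⟨V, _, _, _, _, _, _, e⟩ := h
    simp only [e, moduleCharacter, LinearMap.comp_apply, AlgHom.toLinearMap_apply, map_mul]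
    exact LinearMap.trace_mul_comm k _ _
  | zero => simp
  | add χ ψ _ _ h1 h2 => simp only [map_add, LinearMap.add_apply, h1, h2]
  | smul c χ _ h => simp only [map_smul, LinearMap.smul_apply, h]

variable [Module.Finite k H]

instance finite_dualAlgebra : Module.Finite k (DualAlgebra k H) :=
  Module.Finite.equiv (toLin (k := k) (H := H)).symm

instance finite_characterAlgebra : Module.Finite k (characterAlgebra k H) :=
  inferInstanceAs (Module.Finite k (characterAlgebra k H).toSubmodule)

/-- Left multiplication by `p` on `H^*` is the transpose of `h ↦ h ↼ p`. -/
theorem trace_mul_eq_trace_rightHitL (p : DualAlgebra k H) :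
    LinearMap.trace k (DualAlgebra k H) (Algebra.lmul k _ p) =
      LinearMap.trace k H (rightHitL (toLin p)) := by
  rw [← LinearMap.trace_transpose' (rightHitL _),
    ← LinearMap.trace_conj' _ (toLin (k := k) (H := H))]
  congr 1
  ext q h
  obtain ⟨q, rfl⟩ := toLin.surjective q
  simp only [LinearEquiv.conj_apply_apply, LinearEquiv.symm_apply_apply]
  exact toLin_mul_eq_rightHitL p q h

/-- A central element of a semisimple Hopf algebra on which all characters vanish is zero: by
Schur's lemma it acts as zero on every simple module. -/
theorem eq_zero_of_forall_character_eq_zero [IsAlgClosed k] [CharZero k] [IsSemisimpleRing H]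
    {z : H} (hz : z ∈ Subalgebra.center k H) (h : ∀ χ ∈ characterAlgebra k H, toLin χ z = 0) :
    z = 0 := by
  have hmem : z ∈ Ring.jacobson H := by
    rw [Ring.jacobson_eq_sInf_isMaximal, Ideal.mem_sInf]
    intro m hm
    have hs : IsSimpleModule H (H ⧸ m) := isSimpleModule_iff_isCoatom.2 (Ideal.isMaximal_def.1 hm)
    have : Module.Finite k (H ⧸ m) :=
      Module.Finite.of_surjective (m.mkQ.restrictScalars k) m.mkQ_surjective
    let L : Module.End H (H ⧸ m) :=
      { toFun := fun v => z • v
        map_add' := smul_add z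
        map_smul' := fun a v => by
          rw [RingHom.id_apply, ← mul_smul, ← mul_smul, Subalgebra.mem_center_iff.1 hz a] }
    obtain ⟨c, hc⟩ := (IsSimpleModule.algebraMap_end_bijective_of_isAlgClosed (A := H)
      (V := H ⧸ m) k).2 L
    have hzv : ∀ v : H ⧸ m, z • v = c • v := fun v => (LinearMap.congr_fun hc v).symm
    have h1 : toLin (toLin.symm (moduleCharacter k H (H ⧸ m))) z = 0 :=
      h _ (moduleCharacter_mem_span _ (H ⧸ m) rfl)
    have h2 : (Algebra.lsmul k k (H ⧸ m) z : Module.End k (H ⧸ m)) = c • 1 :=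
      LinearMap.ext hzv
    have := hs.nontrivial
    rw [LinearEquiv.apply_symm_apply, moduleCharacter, LinearMap.comp_apply,
      AlgHom.toLinearMap_apply, h2, map_smul, LinearMap.trace_one, smul_eq_mul, mul_eq_zero,
      Nat.cast_eq_zero, or_iff_left Module.finrank_pos.ne'] at h1
    have h3 := hzv (m.mkQ 1)
    rw [h1, zero_smul, ← map_smul, smul_eq_mul, mul_one] at h3
    exact (Submodule.Quotient.mk_eq_zero m).1 h3
  rwa [IsSemisimpleRing.jacobson_eq_bot] at hmem

variable [IsAlgClosed k] [CharZero k] [IsSemisimpleRing H] {Λ : H}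

/-- `d Λ` is the regular character of `H^*`. -/
theorem IsHaarIntegral.trace_mul (hΛ : IsHaarIntegral k Λ) (p : DualAlgebra k H) :
    LinearMap.trace k (DualAlgebra k H) (Algebra.lmul k _ p) = Module.finrank k H * toLin p Λ := by
  rw [trace_mul_eq_trace_rightHitL, hΛ.trace_rightHitL]

theorem IsHaarIntegral.toLin_mul_comm (hΛ : IsHaarIntegral k Λ) (p q : DualAlgebra k H) :
    toLin (p * q) Λ = toLin (q * p) Λ := by
  refine mul_left_cancel₀ hΛ.finrank_ne_zero ?_
  rw [← hΛ.trace_mul, ← hΛ.trace_mul, map_mul (Algebra.lmul k _), LinearMap.trace_mul_comm,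
    ← map_mul (Algebra.lmul k _)]

theorem IsHaarIntegral.finrank_rightIdeal (hΛ : IsHaarIntegral k Λ) {f : DualAlgebra k H}
    (hf : IsIdempotentElem f) :
    (Module.finrank k (rightIdeal f) : k) = Module.finrank k H * toLin f Λ := by
  have h1 : IsIdempotentElem (Algebra.lmul k (DualAlgebra k H) f) := by
    rw [IsIdempotentElem, ← map_mul, hf.eq]
  have h2 : LinearMap.range (Algebra.lmul k (DualAlgebra k H) f) =
      (rightIdeal f).restrictScalars k :=
    Submodule.ext fun y => (mem_rightIdeal f y).symm
  rw [← hΛ.trace_mul, trace_eq_finrank_range h1, h2]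
  rfl

theorem IsHaarIntegral.toLin_ne_zero (hΛ : IsHaarIntegral k Λ) {f : DualAlgebra k H}
    (hf : IsIdempotentElem f) (h0 : f ≠ 0) : toLin f Λ ≠ 0 := by
  intro h
  have h1 := hΛ.finrank_rightIdeal hf
  have : Nontrivial (rightIdeal f) :=
    ⟨⟨⟨f, (mem_rightIdeal f f).2 ⟨1, mul_one f⟩⟩, 0, fun h => h0 (congrArg Subtype.val h)⟩⟩
  rw [h, mul_zero] at h1
  exact Module.finrank_pos.ne' (Nat.cast_eq_zero.1 h1)

theorem IsHaarIntegral.rightHit_mem_center (hΛ : IsHaarIntegral k Λ) {χ : DualAlgebra k H}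
    (hχ : χ ∈ characterAlgebra k H) : rightHit Λ χ ∈ Subalgebra.center k H :=
  hΛ.rightHitL_mem_center (toLin_mul_comm_of_mem hχ)

/-- The character algebra is semisimple: its radical is orthogonal to it for the trace form of
`H^*`, and this form is nondegenerate on it. -/
theorem IsHaarIntegral.isSemisimpleRing_characterAlgebra (hΛ : IsHaarIntegral k Λ) :
    IsSemisimpleRing (characterAlgebra k H) := by
  have : IsArtinianRing (characterAlgebra k H) := IsArtinianRing.of_finite k _
  refine IsArtinianRing.isSemisimpleRing_iff_jacobson.2 ((Submodule.eq_bot_iff _).2 fun y hy => ?_)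
  have hnil : ∀ x, IsNilpotent (y * x) := fun x => by
    obtain ⟨n, hn⟩ := IsSemiprimaryRing.isNilpotent (R := characterAlgebra k H)
    exact ⟨n, (Ideal.zero_eq_bot (R := characterAlgebra k H) ▸ hn).le
      (Ideal.pow_mem_pow (Ideal.mul_mem_right x _ hy) n)⟩
  have h0 : rightHit Λ (y : DualAlgebra k H) = 0 := by
    refine eq_zero_of_forall_character_eq_zero (hΛ.rightHit_mem_center y.2) fun χ hχ => ?_
    rw [apply_rightHit]
    have h1 : IsNilpotent (Algebra.lmul k (DualAlgebra k H) (y * χ)) :=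
      ((hnil ⟨χ, hχ⟩).map (characterAlgebra k H).val).map (Algebra.lmul k (DualAlgebra k H))
    have h2 := (LinearMap.isNilpotent_trace_of_isNilpotent h1).eq_zero
    rw [hΛ.trace_mul] at h2
    exact (mul_eq_zero.1 h2).resolve_left hΛ.finrank_ne_zero
  have h1 : toLin (y : DualAlgebra k H) = 0 := hΛ.rightHitL_injective (by
    rw [← rightHit_eq_rightHitL, h0, map_zero, LinearMap.zero_apply])
  exact Subtype.ext (toLin.map_eq_zero_iff.1 h1)

theorem IsHaarIntegral.normalizedClassSum_mem_center (hΛ : IsHaarIntegral k Λ)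
    (F f : characterAlgebra k H) : normalizedClassSum Λ F f ∈ Subalgebra.center k H :=
  Subalgebra.smul_mem _ (hΛ.rightHit_mem_center (Subalgebra.smul_mem _ F.2 _)) _

/-- The class sum represents the trace form `x ↦ d ⟨F x, Λ⟩` on the block of `F`, which is a
multiple of the character of `f R(H)`; the factor `d ⟨f, Λ⟩` is the dimension of `f H^*`. -/
theorem IsHaarIntegral.toLin_normalizedClassSum (hΛ : IsHaarIntegral k Λ)
    {F f : characterAlgebra k H} (hF : IsCentralPrimitiveIdempotent F)
    (hf : IsPrimitiveIdempotent f) (hfF : f * F = f) (x : characterAlgebra k H) :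
    toLin (x : DualAlgebra k H) (normalizedClassSum Λ F f) = rightIdealCharacter k f x := by
  have := hΛ.isSemisimpleRing_characterAlgebra
  let t : characterAlgebra k H →ₗ[k] k :=
    LinearMap.applyₗ Λ ∘ₗ toLin.toLinearMap ∘ₗ (characterAlgebra k H).val.toLinearMap
  have ht : toLin ((F : DualAlgebra k H) * (x : DualAlgebra k H)) Λ =
      toLin (f : DualAlgebra k H) Λ * rightIdealCharacter k f x :=
    hF.apply_mul_eq hf hfF t (fun x y => hΛ.toLin_mul_comm _ _) x
  have hi : IsIdempotentElem (f : DualAlgebra k H) := congrArg Subtype.val hf.idem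
  have hτ := hΛ.toLin_ne_zero hi fun h => hf.ne_zero (Subtype.ext h)
  rw [normalizedClassSum, classSum, map_smul, apply_rightHit, smul_mul_assoc, map_smul,
    LinearMap.smul_apply, ht, hΛ.finrank_rightIdeal hi, smul_eq_mul, smul_eq_mul, ← mul_assoc,
    ← mul_assoc, mul_assoc _ (Module.finrank k H : k),
    inv_mul_cancel₀ (mul_ne_zero hΛ.finrank_ne_zero hτ), one_mul]

end CharacterAlgebra

end HopfCharacter

theorem mainTheorem5 {k H : Type*} [Field k] [IsAlgClosed k] [CharZero k]
    [Ring H] [HopfAlgebra k H] [Module.Finite k H] [IsSemisimpleRing H]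
    (Λ : H) (hΛ : HopfCharacter.IsNormalizedIntegral k Λ)
    (F f : HopfCharacter.characterAlgebra k H)
    (hF : HopfCharacter.IsCentralPrimitiveIdempotent F)
    (hf : HopfCharacter.IsPrimitiveIdempotent f) (hfF : f * F = f) :
    IsSimpleModule (HopfCharacter.characterAlgebra k H)ᵐᵒᵖ (HopfCharacter.rightIdeal f) ∧
    HopfCharacter.normalizedClassSum Λ F f ∈ Subalgebra.center k H ∧
    (∀ x : HopfCharacter.characterAlgebra k H,
      HopfCharacter.rightIdealCharacter k f x =
        HopfCharacter.DualAlgebra.toLin (x : HopfCharacter.DualAlgebra k H) (HopfCharacter.normalizedClassSum Λ F f)) ∧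
    (∀ z ∈ Subalgebra.center k H,
      (∀ x : HopfCharacter.characterAlgebra k H,
        HopfCharacter.rightIdealCharacter k f x =
          HopfCharacter.DualAlgebra.toLin (x : HopfCharacter.DualAlgebra k H) z) →
      z = HopfCharacter.normalizedClassSum Λ F f) ∧
    Coalgebra.counit (R := k) (HopfCharacter.normalizedClassSum Λ F f) =
      (Module.finrank k (HopfCharacter.rightIdeal f) : k) ∧
    (∀ (m : ℕ) (g : Fin m → HopfCharacter.characterAlgebra k H),
      HopfCharacter.IsFullPrimitiveSystem F g →
        Coalgebra.counit (R := k) (HopfCharacter.normalizedClassSum Λ F f) = (m : k)) := by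
  have hH := hΛ.isHaarIntegral
  have := hH.isSemisimpleRing_characterAlgebra
  have hc := hH.normalizedClassSum_mem_center F f
  have hη := hH.toLin_normalizedClassSum hF hf hfF
  have hε : Coalgebra.counit (R := k) (HopfCharacter.normalizedClassSum Λ F f) =
      (Module.finrank k (HopfCharacter.rightIdeal f) : k) := by
    rw [← HopfCharacter.blockCharacter_one, HopfCharacter.blockCharacter_apply, ← hη]
    rfl
  refine ⟨hf.isSimpleModule_rightIdeal, hc, fun x => (hη x).symm, fun z hz h => ?_, hε,
    fun m g hg => hε.trans (hg.card_eq_finrank hF hf hfF)⟩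
  rw [← sub_eq_zero]
  refine HopfCharacter.eq_zero_of_forall_character_eq_zero (sub_mem hz hc) fun χ hχ => ?_
  rw [map_sub, hη ⟨χ, hχ⟩, h ⟨χ, hχ⟩, sub_self]
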